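/- Let $\mathbb{P}^1$ be the monoid scheme over $\mathbb{F}_1$ obtained by gluing $U_0=\operatorname{Spec}\langle t\rangle$ and $U_\infty=\operatorname{Spec}\langle t^{-1}\rangle$ along $\operatorname{Spec}\langle t,t^{-1}\rangle$, where $\langle t\rangle=\{0,1,t,t^2,\dots\}$, $\langle t^{-1}\rangle=\{0,1,t^{-1},t^{-2},\dots\}$ and $\langle t,t^{-1}\rangle=\{0\}\cup\{t^k: k\in\mathbb{Z}\}$ are commutative monoids with zero; its points are the two closed points $0,\infty$ and the generic point $\eta$. A coherent sheaf on $\mathbb{P}^1$ is a sheaf of pointed sets with an action of the structure sheaf (the zero section acting as the base point) which on each of the affine open sets $U_0, U_\infty$ is the sheaf associated with a finitely generated module; it is normal if for every affine open $U$ and every $a\in\mathcal{O}(U)$ the map $m\mapsto a\cdot m$ on the sections over $U$ is injective outside the preimage of the base point. Direct sums $\oplus$ are formed by identifying base points (wedge of pointed sets) on affine open sets, and the quotient $\mathcal{F}/\mathcal{F}'$ by a coherent subsheaf by collapsing $\mathcal{F}'$ to the base point on affine open sets. A sheaf is indecomposable if it is not a direct sum of two non-zero sheaves. For $m\in\mathbb{Z}$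 and $n\in\mathbb{Z}_{\ge 1}$ let: - $\mathcal{O}(m)$ be the line bundle obtained by gluing $\langle t\rangle$ on $U_0$ and $\langle t^{-1}\rangle$ on $U_\infty$ along $t^k\mapsto t^{k-m}$; - $\mathcal{T}_{x,n}$, $x\in\{0,\infty\}$, be the torsion sheaf supported at $x$ obtained from the module $\langle u\rangle/\{0,u^n,u^{n+1},\dots\}$, where $u=t$ if $x=0$ and $u=t^{-1}$ if $x=\infty$, glued with the zero module; - $\mathcal{C}_n$ be the cyclic sheaf given on $U_0$ and on $U_\infty$ by the module $\{*\}\cup\{z_{[i]}: [i]\in\mathbb{Z}/n\mathbb{Z}\}$ with $t^{\pm1}\cdot z_{[i]}=z_{[i\pm1]}$, glued by the identity. Let $\mathbf{H}$ be the Hall algebra of normal coherent sheaves on $\mathbb{P}^1$: the space of finitely supported functions from the set of isomorphism classes of normal coherent sheaves on $\mathbb{P}^1$ to $\mathbb{C}$, with the convolution product $$(f\cdot g)(\mathcal{F})=\sum_{\mathcal{F}'\subset\mathcal{F}} f(\mathcal{F}/\mathcal{F}')\,g(\mathcal{F}'),$$ the sum being over all coherent subsheaves $\mathcal{F}'$ of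 $\mathcal{F}$ (only finitely many terms are non-zero). Write $\overline{\mathcal{F}}\in\mathbf{H}$ for the delta function of the isomorphism class of $\mathcal{F}$. **Theorem.** The following identities hold in $\mathbf{H}$ (where $n,m$ are integers, required to be $\geq 1$ when they are the second index of a sheaf $\mathcal{T}$ or the index of a sheaf $\mathcal{C}$, and $x,x'\in\{0,\infty\}$): \begin{align*} \overline{\mathcal{O}(n)}\cdot\overline{\mathcal{O}(m)} &= \overline{\mathcal{O}(n)\oplus\mathcal{O}(m)} \quad\text{if } m\neq n,\\ \overline{\mathcal{T}_{x,n}}\cdot\overline{\mathcal{O}(m)} &= \overline{\mathcal{O}(n+m)}+\overline{\mathcal{T}_{x,n}\oplus\mathcal{O}(m)},\\ \overline{\mathcal{O}(m)}\cdot\overline{\mathcal{T}_{x,n}} &= \overline{\mathcal{T}_{x,n}\oplus\mathcal{O}(m)},\\ \overline{\mathcal{T}_{x,n}}\cdot\overline{\mathcal{T}_{x,m}} &= \overline{\mathcal{T}_{x,n+m}}+\overline{\mathcal{T}_{x,n}\oplus\mathcal{T}_{x,m}} \quad\text{if } m\neq n,\\ \overline{\mathcal{T}_{x,n}}\cdot\overline{\mathcal{T}_{x',m}}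 &= \overline{\mathcal{T}_{x,n}\oplus\mathcal{T}_{x',m}} \quad\text{if } x\neq x',\\ \overline{\mathcal{C}_n}\cdot\overline{\mathcal{F}} &= \overline{\mathcal{C}_n\oplus\mathcal{F}} \quad\text{if } \mathcal{F} \text{ is an indecomposable normal coherent sheaf and } \overline{\mathcal{F}}\neq\overline{\mathcal{C}_n}. \end{align*} -/

import Mathlib

open CategoryTheory TopologicalSpace Opposite

noncomputable section

namespace FunP1

/-! ## The monoid scheme `P¹` over `F₁` -/

/-- The points of `P¹`: the closed points `0`, `∞` and the generic point `η`. -/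
inductive P1 : Type
  | zero
  | infty
  | gen

/-- The open sets are the empty set and all sets that contain the generic point, that is
`∅`, `{η}`, `U₀ = {0, η}`, `U_∞ = {∞, η}` and `P¹`. -/
instance P1.instTopologicalSpace : TopologicalSpace P1 where
  IsOpen U := U.Nonempty → P1.gen ∈ U
  isOpen_univ := fun _ => trivial
  isOpen_inter := fun _ _ hs ht hn =>
    ⟨hs (hn.mono Set.inter_subset_left), ht (hn.mono Set.inter_subset_right)⟩
  isOpen_sUnion := by
    rintro S hS ⟨x, U, hU, hx⟩
    exact ⟨U, hU, hS U hU ⟨x, hx⟩⟩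

theorem gen_mem {U : Opens P1} {x : P1} (hx : x ∈ U) : P1.gen ∈ U := U.2 ⟨x, hx⟩

/-- The smallest open neighbourhood of a point; it is the affine open set `U₀`, `U_∞`, `{η}`
for `x = 0`, `∞`, `η`. These three are the non-empty affine open sets of `P¹`. -/
def nhd (x : P1) : Opens P1 := ⟨{x, P1.gen}, fun _ => Or.inr rfl⟩

theorem mem_nhd (x : P1) : x ∈ nhd x := Or.inl rfl

theorem nhd_le {U : Opens P1} {x : P1} (hx : x ∈ U) : nhd x ≤ U := by
  rintro y (rfl | rfl)
  · exact hx
  · exact gen_mem hx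

theorem nhd_gen_le (x : P1) : nhd P1.gen ≤ nhd x := nhd_le (gen_mem (mem_nhd x))

/-- The monoid with zero `⟨t, t⁻¹⟩ = {0} ∪ {t ^ k | k ∈ ℤ}`. -/
abbrev K : Type := WithZero (Multiplicative ℤ)

/-- The coordinate `t`. -/
def t : K := ((Multiplicative.ofAdd (1 : ℤ) : Multiplicative ℤ) : K)

/-- The local coordinate: `t` at `0`, `t⁻¹` at `∞`, and `1` at `η`. -/
def unif : P1 → K
  | P1.zero => t
  | P1.infty => t⁻¹
  | P1.gen => 1

/-- The stalks of the structure sheaf inside `⟨t, t⁻¹⟩`: `⟨t⟩` at `0`, `⟨t⁻¹⟩` at `∞`, and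
`⟨t, t⁻¹⟩` at `η`. -/
def stalk : P1 → Set K
  | P1.zero => {a | a = 0 ∨ ∃ k : ℕ, a = t ^ k}
  | P1.infty => {a | a = 0 ∨ ∃ k : ℕ, a = t⁻¹ ^ k}
  | P1.gen => Set.univ

theorem zero_mem_stalk (x : P1) : (0 : K) ∈ stalk x := by
  cases x
  · exact Or.inl rfl
  · exact Or.inl rfl
  · trivial

theorem one_mem_stalk (x : P1) : (1 : K) ∈ stalk x := by
  cases x
  · exact Or.inr ⟨0, by simp⟩
  · exact Or.inr ⟨0, by simp⟩
  · trivial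

theorem mul_mem_stalk (x : P1) {a b : K} (ha : a ∈ stalk x) (hb : b ∈ stalk x) :
    a * b ∈ stalk x := by
  cases x
  · rcases ha with rfl | ⟨k, rfl⟩
    · exact Or.inl (zero_mul _)
    rcases hb with rfl | ⟨l, rfl⟩
    · exact Or.inl (mul_zero _)
    exact Or.inr ⟨k + l, by rw [pow_add]⟩
  · rcases ha with rfl | ⟨k, rfl⟩
    · exact Or.inl (zero_mul _)
    rcases hb with rfl | ⟨l, rfl⟩
    · exact Or.inl (mul_zero _)
    exact Or.inr ⟨k + l, by rw [pow_add]⟩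
  · trivial

theorem unif_mem_stalk (x : P1) : unif x ∈ stalk x := by
  cases x
  · exact Or.inr ⟨1, by simp [unif]⟩
  · exact Or.inr ⟨1, by simp [unif]⟩
  · trivial

/-- The sections over `U` of the structure sheaf: the constant functions (every open set is
connected) with value in the stalk at each point of `U`. -/
def Osec (U : Opens P1) : Type :=
  {s : U → K // (∀ x y, s x = s y) ∧ ∀ x : U, s x ∈ stalk x}

instance (U : Opens P1) : Zero (Osec U) :=
  ⟨⟨0, fun _ _ => rfl, fun x => zero_mem_stalk x⟩⟩

instance (U : Opens P1) : One (Osec U) :=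
  ⟨⟨1, fun _ _ => rfl, fun x => one_mem_stalk x⟩⟩

instance (U : Opens P1) : Mul (Osec U) :=
  ⟨fun a b => ⟨a.1 * b.1, fun x y => by simp only [Pi.mul_apply, a.2.1 x y, b.2.1 x y],
    fun x => mul_mem_stalk x (a.2.2 x) (b.2.2 x)⟩⟩

instance (U : Opens P1) : CommMonoidWithZero (Osec U) where
  mul_assoc a b c := Subtype.ext (mul_assoc a.1 b.1 c.1)
  one_mul a := Subtype.ext (one_mul a.1)
  mul_one a := Subtype.ext (mul_one a.1)
  mul_comm a b := Subtype.ext (mul_comm a.1 b.1)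
  zero_mul a := Subtype.ext (zero_mul a.1)
  mul_zero a := Subtype.ext (mul_zero a.1)

/-- Restriction of functions. -/
def Ores {U V : Opens P1} (h : V ≤ U) : Osec U →*₀ Osec V where
  toFun a := ⟨fun x => a.1 ⟨x, h x.2⟩, fun _ _ => a.2.1 _ _, fun x => a.2.2 ⟨x, h x.2⟩⟩
  map_zero' := rfl
  map_one' := rfl
  map_mul' _ _ := rfl

/-- An element of the stalk at `x`, as a function on the smallest neighbourhood of `x`. -/
def Oconst (x : P1) (a : K) (ha : a ∈ stalk x) : Osec (nhd x) :=
  ⟨fun _ => a, fun _ _ => rfl, by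
    rintro ⟨y, rfl | rfl⟩
    · exact ha
    · trivial⟩

/-- The value of a function on the smallest neighbourhood of `x`. -/
def Oval (x : P1) : Osec (nhd x) →*₀ K where
  toFun a := a.1 ⟨x, mem_nhd x⟩
  map_zero' := rfl
  map_one' := rfl
  map_mul' _ _ := rfl

/-- The local coordinate as a function on the smallest neighbourhood. -/
def coord (x : P1) : Osec (nhd x) := Oconst x (unif x) (unif_mem_stalk x)

theorem Oval_injective (x : P1) : Function.Injective (Oval x) := by
  intro a b h
  refine Subtype.ext (funext fun y => ?_)
  rw [a.2.1 y ⟨x, mem_nhd x⟩, b.2.1 y ⟨x, mem_nhd x⟩]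
  exact h

theorem Oval_res (x : P1) (a : Osec (nhd x)) :
    Oval P1.gen (Ores (nhd_gen_le x) a) = Oval x a := a.2.1 _ _

/-! ## Sheaves of modules -/

/-- A sheaf of modules over the structure sheaf: a sheaf of sets, with a base point `0` in each
set of sections and an action of the functions on the sections, compatible with restriction. -/
structure OMod where
  sheaf : TopCat.Sheaf Type (TopCat.of P1)
  [zero : ∀ U : Opens P1, Zero (sheaf.obj.obj (op U))]
  [act : ∀ U : Opens P1, MulActionWithZero (Osec U) (sheaf.obj.obj (op U))]
  map_smul : ∀ {U V : Opens P1} (h : V ≤ U) (a : Osec U) (m : sheaf.obj.obj (op U)),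
    sheaf.obj.map (homOfLE h).op (a • m) = Ores h a • sheaf.obj.map (homOfLE h).op m

namespace OMod

/-- The sections over an open set. -/
abbrev Sec (F : OMod) (U : Opens P1) : Type := F.sheaf.obj.obj (op U)

instance (F : OMod) (U : Opens P1) : Zero (F.Sec U) := F.zero U
instance (F : OMod) (U : Opens P1) : MulActionWithZero (Osec U) (F.Sec U) := F.act U

/-- Restriction of sections. -/
def res (F : OMod) {U V : Opens P1} (h : V ≤ U) (s : F.Sec U) : F.Sec V :=
  F.sheaf.obj.map (homOfLE h).op s

theorem res_smul (F : OMod) {U V : Opens P1} (h : V ≤ U) (a : Osec U) (s : F.Sec U) :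
    F.res h (a • s) = Ores h a • F.res h s := F.map_smul h a s

theorem res_zero (F : OMod) {U V : Opens P1} (h : V ≤ U) : F.res h (0 : F.Sec U) = 0 := by
  have := F.res_smul h 0 (0 : F.Sec U)
  rwa [zero_smul, map_zero, zero_smul] at this

theorem res_refl (F : OMod) {U : Opens P1} (h : U ≤ U) (s : F.Sec U) : F.res h s = s := by
  have : (homOfLE h).op = 𝟙 (op U) := rfl
  rw [res, this, F.sheaf.obj.map_id]
  rfl

theorem res_res (F : OMod) {U V W : Opens P1} (h : V ≤ U) (h' : W ≤ V) (s : F.Sec U) :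
    F.res h' (F.res h s) = F.res (h'.trans h) s := by
  have : (homOfLE (h'.trans h)).op = (homOfLE h).op ≫ (homOfLE h').op := rfl
  rw [res, res, res, this, F.sheaf.obj.map_comp]
  rfl

end OMod

/-- Isomorphisms of sheaves of modules: bijections on the sections over every open set that
commute with the action (hence preserve the base point) and with restriction. -/
structure OMod.Iso (F G : OMod) where
  equiv : ∀ U : Opens P1, F.Sec U ≃ G.Sec U
  map_smul : ∀ (U : Opens P1) (a : Osec U) (s : F.Sec U), equiv U (a • s) = a • equiv U s
  map_res : ∀ {U V : Opens P1} (h : V ≤ U) (s : F.Sec U),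
    equiv V (F.res h s) = G.res h (equiv U s)

namespace OMod.Iso

def refl (F : OMod) : OMod.Iso F F := ⟨fun _ => Equiv.refl _, fun _ _ _ => rfl, fun _ _ => rfl⟩

def symm {F G : OMod} (e : OMod.Iso F G) : OMod.Iso G F where
  equiv U := (e.equiv U).symm
  map_smul U a s := by rw [Equiv.symm_apply_eq, e.map_smul, Equiv.apply_symm_apply]
  map_res h s := by rw [Equiv.symm_apply_eq, e.map_res, Equiv.apply_symm_apply]

def trans {F G H : OMod} (e : OMod.Iso F G) (e' : OMod.Iso G H) : OMod.Iso F H where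
  equiv U := (e.equiv U).trans (e'.equiv U)
  map_smul U a s := by simp [e.map_smul, e'.map_smul]
  map_res h s := by simp [e.map_res, e'.map_res]

end OMod.Iso

/-! ## Germs, gluing, coherence and normality -/

/-- Gluing data for a sheaf of modules on `P¹`: a module `M x` over the functions on the smallest
neighbourhood of each point `x`, with equivariant maps from `M 0` and `M ∞` to `M η`. -/
structure LMod where
  M : P1 → Type
  [zero : ∀ x, Zero (M x)]
  [act : ∀ x, MulActionWithZero (Osec (nhd x)) (M x)]
  toGen : ∀ x, M x → M P1.gen
  toGen_gen : ∀ m, toGen P1.gen m = m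
  map_smul : ∀ x (a : Osec (nhd x)) (m : M x),
    toGen x (a • m) = Ores (nhd_gen_le x) a • toGen x m

namespace LMod

instance (L : LMod) (x : P1) : Zero (L.M x) := L.zero x
instance (L : LMod) (x : P1) : MulActionWithZero (Osec (nhd x)) (L.M x) := L.act x

theorem toGen_zero (L : LMod) (x : P1) : L.toGen x 0 = 0 := by
  have := L.map_smul x 0 0
  rwa [zero_smul, map_zero, zero_smul] at this

/-- Each `M x` is finitely generated over the functions on `nhd x`. -/
def FG (L : LMod) : Prop :=
  ∀ x, ∃ S : Set (L.M x), S.Finite ∧ ∀ m, ∃ (a : Osec (nhd x)), ∃ s ∈ S, a • s = m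

/-- The map `M x → M η` is the localization of `M x` at the powers of the local coordinate, so
that `M` is, on the affine open set `nhd x`, the sheaf associated with the module `M x`. -/
def QCoh (L : LMod) : Prop :=
  ∀ x, (∀ m' : L.M P1.gen, ∃ (k : ℕ) (m : L.M x),
      Ores (nhd_gen_le x) (coord x ^ k) • m' = L.toGen x m) ∧
    ∀ m m' : L.M x, L.toGen x m = L.toGen x m' → ∃ k : ℕ, coord x ^ k • m = coord x ^ k • m'

/-- Each function on `nhd x` acts on `M x` injectively away from the preimage of `0`. -/
def Normal (L : LMod) : Prop :=
  ∀ x (a : Osec (nhd x)) (m m' : L.M x), a • m = a • m' → a • m ≠ 0 → m = m'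

/-- The families of elements of `M x`, `x ∈ U`, that agree at the generic point; these are the
sections over `U` of the sheaf glued from `L`. -/
def pred (L : LMod) : TopCat.LocalPredicate (X := TopCat.of P1) L.M where
  pred {U} s := ∀ (x : P1) (hx : x ∈ U), L.toGen x (s ⟨x, hx⟩) = s ⟨P1.gen, gen_mem hx⟩
  res {U V} i f h := fun x hx => h x (i.le hx)
  locality {U} f w := by
    intro x hx
    obtain ⟨V, hV, i, h⟩ := w ⟨x, hx⟩
    exact h x hV

/-- The sections over `U` of the sheaf glued from `L`. -/
def GlueSec (L : LMod) (U : Opens P1) : Type :=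
  {s : ∀ x : U, L.M x // ∀ (x : P1) (hx : x ∈ U), L.toGen x (s ⟨x, hx⟩) = s ⟨P1.gen, gen_mem hx⟩}

instance (L : LMod) (U : Opens P1) : Zero (L.GlueSec U) :=
  ⟨⟨fun _ => 0, fun _ _ => L.toGen_zero _⟩⟩

instance (L : LMod) (U : Opens P1) : MulActionWithZero (Osec U) (L.GlueSec U) where
  smul a s := ⟨fun x => Ores (nhd_le x.2) a • s.1 x, fun x hx => by
    refine (L.map_smul x _ _).trans ?_
    rw [s.2 x hx]
    rfl⟩
  one_smul s := Subtype.ext (funext fun x => one_smul _ (s.1 x))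
  mul_smul a b s := Subtype.ext (funext fun x =>
    mul_smul (Ores (nhd_le x.2) a) (Ores (nhd_le x.2) b) (s.1 x))
  smul_zero a := Subtype.ext (funext fun x => smul_zero (Ores (nhd_le x.2) a))
  zero_smul s := Subtype.ext (funext fun x => zero_smul _ (s.1 x))

/-- The sheaf of modules glued from `L`. -/
def glue (L : LMod) : OMod where
  sheaf := TopCat.subsheafToTypes L.pred
  zero U := inferInstanceAs (Zero (L.GlueSec U))
  act U := inferInstanceAs (MulActionWithZero (Osec U) (L.GlueSec U))
  map_smul _ _ _ := rfl

end LMod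

/-- The sections of `F` on the smallest neighbourhoods of the points (the stalks of `F`). -/
def OMod.germs (F : OMod) : LMod where
  M x := F.Sec (nhd x)
  toGen x := F.res (nhd_gen_le x)
  toGen_gen m := F.res_refl _ m
  map_smul _ a m := F.res_smul _ a m

/-- Coherent sheaves: each point has an affine open neighbourhood on which the sheaf is the one
associated with a finitely generated module. (The only affine open neighbourhood of a closed
point is the smallest one, and the condition for `η` follows from those for `0` and `∞`.) -/
def OMod.Coherent (F : OMod) : Prop := F.germs.FG ∧ F.germs.QCoh

/-- Normal sheaves: the sections over each affine open set form a normal module. -/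
def OMod.Normal (F : OMod) : Prop := F.germs.Normal

open Classical in
/-- The germs of a glued sheaf are the modules that were glued. -/
def LMod.germEquiv (L : LMod) (x : P1) : L.glue.germs.M x ≃ L.M x where
  toFun := fun s : L.GlueSec (nhd x) => s.1 ⟨x, mem_nhd x⟩
  invFun := fun m => (⟨fun y =>
      if h : y.1 = x then (congrArg L.M h.symm).mp m
      else (congrArg L.M (y.2.resolve_left h).symm).mp (L.toGen x m), by
    rintro y (rfl | rfl)
    · by_cases h : P1.gen = y
      · subst h
        simp [L.toGen_gen]
      · simp [h]
    · exact L.toGen_gen _⟩ : L.GlueSec (nhd x))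
  left_inv := fun s : L.GlueSec (nhd x) => by
    refine Subtype.ext (funext ?_)
    rintro ⟨y, rfl | rfl⟩
    · simp
    · by_cases h : P1.gen = x
      · subst h
        simp
      · simpa [h] using s.2 x (mem_nhd x)
  right_inv m := by simp

theorem LMod.germEquiv_smul (L : LMod) (x : P1) (a : Osec (nhd x)) (s : L.glue.germs.M x) :
    L.germEquiv x (a • s) = a • L.germEquiv x s := rfl

theorem LMod.germEquiv_zero (L : LMod) (x : P1) : L.germEquiv x 0 = 0 := rfl

theorem LMod.germEquiv_toGen (L : LMod) (x : P1) (s : L.glue.germs.M x) :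
    L.germEquiv P1.gen (L.glue.germs.toGen x s) = L.toGen x (L.germEquiv x s) := by
  change L.GlueSec (nhd x) at s
  exact (s.2 x (mem_nhd x)).symm

theorem LMod.glue_coherent (L : LMod) (h : L.FG) (h' : L.QCoh) : L.glue.Coherent := by
  refine ⟨fun x => ?_, fun x => ⟨fun m' => ?_, fun m m' hm => ?_⟩⟩
  · obtain ⟨S, hS, hg⟩ := h x
    refine ⟨(L.germEquiv x).symm '' S, hS.image _, fun m => ?_⟩
    obtain ⟨a, s, hs, e⟩ := hg (L.germEquiv x m)
    refine ⟨a, _, ⟨s, hs, rfl⟩, (L.germEquiv x).injective ?_⟩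
    rw [L.germEquiv_smul, Equiv.apply_symm_apply, e]
  · obtain ⟨k, m, e⟩ := (h' x).1 (L.germEquiv _ m')
    refine ⟨k, (L.germEquiv x).symm m, (L.germEquiv _).injective ?_⟩
    rw [L.germEquiv_smul, L.germEquiv_toGen, Equiv.apply_symm_apply, e]
  · obtain ⟨k, e⟩ := (h' x).2 (L.germEquiv x m) (L.germEquiv x m') (by
      rw [← L.germEquiv_toGen, ← L.germEquiv_toGen, hm])
    refine ⟨k, (L.germEquiv x).injective ?_⟩
    rw [L.germEquiv_smul, L.germEquiv_smul, e]

theorem LMod.glue_normal (L : LMod) (h : L.Normal) : L.glue.Normal := by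
  intro x a m m' e hne
  refine (L.germEquiv x).injective (h x a _ _ ?_ fun h0 => hne ?_)
  · rw [← L.germEquiv_smul, ← L.germEquiv_smul, e]
  · exact (L.germEquiv x).injective
      ((L.germEquiv_smul x a m).trans (h0.trans (L.germEquiv_zero x).symm))

/-! ## Normal coherent sheaves, subsheaves, quotients and direct sums -/

/-- Normal coherent sheaves on `P¹`. -/
structure NCoh where
  mod : OMod
  coherent : mod.Coherent
  normal : mod.Normal

/-- A subsheaf of modules. -/
@[ext]
structure Subsheaf (F : OMod) where
  carrier : ∀ U : Opens P1, Set (F.Sec U)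
  zero_mem : ∀ U, 0 ∈ carrier U
  smul_mem : ∀ U (a : Osec U), ∀ s ∈ carrier U, a • s ∈ carrier U
  res_mem : ∀ {U V : Opens P1} (h : V ≤ U), ∀ s ∈ carrier U, F.res h s ∈ carrier V
  local_mem : ∀ (U : Opens P1) (s : F.Sec U),
    (∀ x ∈ U, ∃ (V : Opens P1) (h : V ≤ U), x ∈ V ∧ F.res h s ∈ carrier V) → s ∈ carrier U

namespace Subsheaf

variable {F : OMod} (N : Subsheaf F)

/-- The presheaf of sections of a subsheaf. -/
def presheaf : TopCat.Presheaf Type (TopCat.of P1) where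
  obj U := N.carrier U.unop
  map i := TypeCat.ofHom fun s => ⟨F.res i.unop.le s.1, N.res_mem _ s.1 s.2⟩
  map_id U := by
    ext s
    exact F.res_refl _ s.1
  map_comp i j := by
    ext s
    exact (F.res_res i.unop.le j.unop.le s.1).symm

theorem presheaf_isSheaf : N.presheaf.IsSheaf := by
  refine TopCat.Presheaf.isSheaf_of_isSheafUniqueGluing_types _ fun ι U sf hsf => ?_
  obtain ⟨s, hs, hu⟩ := F.sheaf.existsUnique_gluing U (fun i => (sf i).1)
    (fun i j => congrArg Subtype.val (hsf i j))
  refine ⟨⟨s, N.local_mem _ s fun x hx => ?_⟩, fun i => Subtype.ext (hs i), fun s' hs' => ?_⟩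
  · obtain ⟨i, hi⟩ := Opens.mem_iSup.mp hx
    refine ⟨U i, le_iSup U i, hi, ?_⟩
    have := hs i
    exact (Set.mem_of_eq_of_mem this (sf i).2)
  · exact Subtype.ext (hu _ fun i => congrArg Subtype.val (hs' i))

/-- The sections of a subsheaf. -/
def SubSec (U : Opens P1) : Type := N.carrier U

instance (U : Opens P1) : Zero (N.SubSec U) := ⟨⟨0, N.zero_mem U⟩⟩

instance (U : Opens P1) : MulActionWithZero (Osec U) (N.SubSec U) where
  smul a s := ⟨a • s.1, N.smul_mem U a s.1 s.2⟩
  one_smul s := Subtype.ext (one_smul _ s.1)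
  mul_smul a b s := Subtype.ext (mul_smul a b s.1)
  smul_zero a := Subtype.ext (smul_zero a)
  zero_smul s := Subtype.ext (zero_smul _ s.1)

/-- A subsheaf as a sheaf of modules. -/
def toOMod : OMod where
  sheaf := ⟨N.presheaf, N.presheaf_isSheaf⟩
  zero U := inferInstanceAs (Zero (N.SubSec U))
  act U := inferInstanceAs (MulActionWithZero (Osec U) (N.SubSec U))
  map_smul h a s := Subtype.ext (F.res_smul h a (Subtype.val s))

/-- The inclusion of a subsheaf. -/
def incl (U : Opens P1) (s : N.toOMod.Sec U) : F.Sec U := Subtype.val s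

theorem incl_injective (U : Opens P1) : Function.Injective (N.incl U) :=
  Subtype.val_injective

theorem incl_mem (U : Opens P1) (s : N.toOMod.Sec U) : N.incl U s ∈ N.carrier U := Subtype.property s

theorem incl_smul (U : Opens P1) (a : Osec U) (s : N.toOMod.Sec U) :
    N.incl U (a • s) = a • N.incl U s := rfl

theorem incl_res {U V : Opens P1} (h : V ≤ U) (s : N.toOMod.Sec U) :
    N.incl V (N.toOMod.res h s) = F.res h (N.incl U s) := rfl

end Subsheaf

/-- A family of submodules of the `M x`, compatible with the maps to `M η`. -/
structure LSub (L : LMod) where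
  carrier : ∀ x, Set (L.M x)
  zero_mem : ∀ x, 0 ∈ carrier x
  smul_mem : ∀ x (a : Osec (nhd x)), ∀ m ∈ carrier x, a • m ∈ carrier x
  toGen_mem : ∀ x, ∀ m ∈ carrier x, L.toGen x m ∈ carrier P1.gen

namespace LSub

variable {L : LMod} (N : LSub L)

/-- The equivalence relation that collapses a submodule to one point. -/
def setoid (x : P1) : Setoid (L.M x) where
  r m m' := m = m' ∨ (m ∈ N.carrier x ∧ m' ∈ N.carrier x)
  iseqv :=
    { refl := fun _ => Or.inl rfl
      symm := by
        rintro _ _ (rfl | ⟨h, h'⟩)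
        · exact Or.inl rfl
        · exact Or.inr ⟨h', h⟩
      trans := by
        rintro _ _ _ (rfl | ⟨h, h'⟩) (rfl | ⟨h'', h'''⟩)
        · exact Or.inl rfl
        · exact Or.inr ⟨h'', h'''⟩
        · exact Or.inr ⟨h, h'⟩
        · exact Or.inr ⟨h, h'''⟩ }

/-- The quotient module `M x / N x`. -/
def QMod (x : P1) : Type := Quotient (N.setoid x)

/-- The class of an element in the quotient module. -/
def cls (x : P1) (m : L.M x) : N.QMod x := Quotient.mk (N.setoid x) m

instance (x : P1) : Zero (N.QMod x) := ⟨N.cls x 0⟩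

instance (x : P1) : MulActionWithZero (Osec (nhd x)) (N.QMod x) where
  smul a := Quotient.map' (fun m => a • m) (by
    rintro m m' (rfl | ⟨h, h'⟩)
    · exact Or.inl rfl
    · exact Or.inr ⟨N.smul_mem x a m h, N.smul_mem x a m' h'⟩)
  one_smul := by
    rintro ⟨m⟩
    exact congrArg (N.cls x) (one_smul _ m)
  mul_smul := by
    rintro a b ⟨m⟩
    exact congrArg (N.cls x) (mul_smul a b m)
  smul_zero a := congrArg (N.cls x) (smul_zero a)
  zero_smul := by
    rintro ⟨m⟩
    exact congrArg (N.cls x) (zero_smul _ m)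

/-- The quotient modules `M x / N x` as gluing data. -/
def quot : LMod where
  M := N.QMod
  toGen x := Quotient.map' (L.toGen x) (by
    rintro m m' (rfl | ⟨h, h'⟩)
    · exact Or.inl rfl
    · exact Or.inr ⟨N.toGen_mem x m h, N.toGen_mem x m' h'⟩)
  toGen_gen := by
    rintro ⟨m⟩
    exact congrArg (N.cls _) (L.toGen_gen m)
  map_smul := by
    rintro x a ⟨m⟩
    exact congrArg (N.cls _) (L.map_smul x a m)

/-- The quotient map. -/
def proj (x : P1) (m : L.M x) : N.quot.M x := N.cls x m

theorem proj_surjective (x : P1) : Function.Surjective (N.proj x) := Quotient.exists_rep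

theorem proj_eq_iff (x : P1) (m m' : L.M x) :
    N.proj x m = N.proj x m' ↔ m = m' ∨ (m ∈ N.carrier x ∧ m' ∈ N.carrier x) :=
  Quotient.eq (r := N.setoid x)

theorem proj_zero (x : P1) : N.proj x 0 = 0 := rfl

theorem proj_smul (x : P1) (a : Osec (nhd x)) (m : L.M x) :
    N.proj x (a • m) = a • N.proj x m := rfl

theorem proj_toGen (x : P1) (m : L.M x) :
    N.proj P1.gen (L.toGen x m) = N.quot.toGen x (N.proj x m) := rfl

theorem quot_fg (h : L.FG) : N.quot.FG := by
  intro x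
  obtain ⟨S, hS, hg⟩ := h x
  refine ⟨N.proj x '' S, hS.image _, fun m => ?_⟩
  obtain ⟨m, rfl⟩ := N.proj_surjective x m
  obtain ⟨a, s, hs, e⟩ := hg m
  exact ⟨a, _, ⟨s, hs, rfl⟩, by rw [← N.proj_smul, e]⟩

theorem quot_qcoh (h : L.QCoh)
    (hN : ∀ x m, L.toGen x m ∈ N.carrier P1.gen → ∃ k : ℕ, coord x ^ k • m ∈ N.carrier x) :
    N.quot.QCoh := by
  intro x
  constructor
  · intro m'
    obtain ⟨m', rfl⟩ := N.proj_surjective _ m'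
    obtain ⟨k, m, e⟩ := (h x).1 m'
    exact ⟨k, N.proj x m, by rw [← N.proj_smul, e, N.proj_toGen]⟩
  · intro m m' e
    obtain ⟨m, rfl⟩ := N.proj_surjective _ m
    obtain ⟨m', rfl⟩ := N.proj_surjective _ m'
    rw [← N.proj_toGen, ← N.proj_toGen, N.proj_eq_iff] at e
    rcases e with e | ⟨e, e'⟩
    · obtain ⟨k, hk⟩ := (h x).2 m m' e
      exact ⟨k, by rw [← N.proj_smul, hk, N.proj_smul]⟩
    · obtain ⟨k, hk⟩ := hN x m e
      obtain ⟨l, hl⟩ := hN x m' e'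
      refine ⟨k + l, ?_⟩
      rw [← N.proj_smul, ← N.proj_smul, N.proj_eq_iff]
      refine Or.inr ⟨?_, ?_⟩
      · rw [pow_add, mul_comm, mul_smul]
        exact N.smul_mem x _ _ hk
      · rw [pow_add, mul_smul]
        exact N.smul_mem x _ _ hl

theorem quot_normal (h : L.Normal) : N.quot.Normal := by
  intro x a m m' e hne
  obtain ⟨m, rfl⟩ := N.proj_surjective _ m
  obtain ⟨m', rfl⟩ := N.proj_surjective _ m'
  rw [← N.proj_smul, ← N.proj_zero, Ne, N.proj_eq_iff] at hne
  rw [← N.proj_smul, ← N.proj_smul, N.proj_eq_iff] at e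
  rcases e with e | ⟨e, -⟩
  · rw [h x a m m' e fun h0 => hne (Or.inl h0)]
  · exact absurd (Or.inr ⟨e, N.zero_mem x⟩) hne

end LSub

/-- A coherent subsheaf. -/
structure CohSub (F : OMod) extends Subsheaf F where
  coherent : toSubsheaf.toOMod.Coherent

namespace CohSub

variable {F : NCoh} (N : CohSub F.mod)

/-- The subsheaf `F'` as an object. -/
def sub : NCoh where
  mod := N.toSubsheaf.toOMod
  coherent := N.coherent
  normal x a m m' e hne := by
    refine N.incl_injective _ (F.normal x a (N.incl _ m) (N.incl _ m') ?_ fun h => hne ?_)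
    · exact congrArg (N.incl _) e
    · exact N.incl_injective _ h

/-- The family of submodules on the smallest neighbourhoods. -/
def lsub : LSub F.mod.germs where
  carrier x := N.carrier (nhd x)
  zero_mem _ := N.zero_mem _
  smul_mem _ a m hm := N.smul_mem _ a m hm
  toGen_mem _ m hm := N.res_mem _ m hm

/-- The quotient sheaf `F / F'`, glued from the quotient modules on the affine open sets. -/
def quot : NCoh where
  mod := N.lsub.quot.glue
  coherent := LMod.glue_coherent _ (N.lsub.quot_fg F.coherent.1)
    (N.lsub.quot_qcoh F.coherent.2 fun x m hm => by
      obtain ⟨k, n, e⟩ := (N.coherent.2 x).1 (⟨_, hm⟩ : N.SubSec _)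
      have e' : F.mod.germs.toGen x (coord x ^ k • m) =
          F.mod.germs.toGen x (N.incl _ n) := by
        rw [F.mod.germs.map_smul]
        exact congrArg (N.incl _) e
      obtain ⟨l, hl⟩ := (F.coherent.2 x).2 _ _ e'
      refine ⟨l + k, ?_⟩
      rw [pow_add, mul_smul, hl]
      exact N.smul_mem _ _ _ (N.incl_mem _ n))
  normal := LMod.glue_normal _ (N.lsub.quot_normal F.normal)

end CohSub

/-- The direct sum `M ∨ M'` of pointed sets: pairs with at most one component different from
`0`. -/
def Wedge (M M' : Type) [Zero M] [Zero M'] : Type := {p : M × M' // p.1 = 0 ∨ p.2 = 0}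

namespace Wedge

variable {M M' : Type} [Zero M] [Zero M']

def inl (m : M) : Wedge M M' := ⟨(m, 0), Or.inr rfl⟩

def inr (m : M') : Wedge M M' := ⟨(0, m), Or.inl rfl⟩

theorem ext {p q : Wedge M M'} (h : p.1.1 = q.1.1) (h' : p.1.2 = q.1.2) : p = q :=
  Subtype.ext (Prod.ext h h')

theorem exists_eq (p : Wedge M M') : (∃ m, p = inl m) ∨ ∃ m, p = inr m := by
  rcases p.2 with h | h
  · exact Or.inr ⟨p.1.2, ext h rfl⟩
  · exact Or.inl ⟨p.1.1, ext rfl h⟩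

instance : Zero (Wedge M M') := ⟨⟨(0, 0), Or.inl rfl⟩⟩

instance {A : Type} [MonoidWithZero A] [MulActionWithZero A M] [MulActionWithZero A M'] :
    MulActionWithZero A (Wedge M M') where
  smul a p := ⟨(a • p.1.1, a • p.1.2), by
    rcases p.2 with h | h
    · exact Or.inl (by rw [h, smul_zero])
    · exact Or.inr (by rw [h, smul_zero])⟩
  one_smul p := ext (one_smul _ _) (one_smul _ _)
  mul_smul a b p := ext (mul_smul a b _) (mul_smul a b _)
  smul_zero a := ext (smul_zero a) (smul_zero a)
  zero_smul p := ext (zero_smul _ _) (zero_smul _ _)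

end Wedge

/-- The direct sums `M x ∨ M' x`. -/
def LMod.sum (L L' : LMod) : LMod where
  M x := Wedge (L.M x) (L'.M x)
  toGen x p := ⟨(L.toGen x p.1.1, L'.toGen x p.1.2), by
    rcases p.2 with h | h
    · exact Or.inl (by rw [h, L.toGen_zero])
    · exact Or.inr (by rw [h, L'.toGen_zero])⟩
  toGen_gen p := Wedge.ext (L.toGen_gen _) (L'.toGen_gen _)
  map_smul x a p := Wedge.ext (L.map_smul x a _) (L'.map_smul x a _)

theorem LMod.sum_fg {L L' : LMod} (h : L.FG) (h' : L'.FG) : (L.sum L').FG := by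
  intro x
  obtain ⟨S, hS, hg⟩ := h x
  obtain ⟨S', hS', hg'⟩ := h' x
  refine ⟨(Wedge.inl '' S ∪ Wedge.inr '' S' : Set (Wedge (L.M x) (L'.M x))),
    (hS.image _).union (hS'.image _), fun p => ?_⟩
  rcases Wedge.exists_eq p with ⟨m, rfl⟩ | ⟨m, rfl⟩
  · obtain ⟨a, s, hs, e⟩ := hg m
    exact ⟨a, _, Or.inl ⟨s, hs, rfl⟩, Wedge.ext e (smul_zero a)⟩
  · obtain ⟨a, s, hs, e⟩ := hg' m
    exact ⟨a, _, Or.inr ⟨s, hs, rfl⟩, Wedge.ext (smul_zero a) e⟩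

theorem LMod.sum_qcoh {L L' : LMod} (h : L.QCoh) (h' : L'.QCoh) : (L.sum L').QCoh := by
  intro x
  constructor
  · intro p
    rcases Wedge.exists_eq p with ⟨m, rfl⟩ | ⟨m, rfl⟩
    · obtain ⟨k, n, e⟩ := (h x).1 m
      exact ⟨k, Wedge.inl n, Wedge.ext e ((smul_zero _).trans (L'.toGen_zero x).symm)⟩
    · obtain ⟨k, n, e⟩ := (h' x).1 m
      exact ⟨k, Wedge.inr n, Wedge.ext ((smul_zero _).trans (L.toGen_zero x).symm) e⟩
  · intro (p : Wedge (L.M x) (L'.M x)) (q : Wedge (L.M x) (L'.M x)) e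
    obtain ⟨k, hk⟩ := (h x).2 p.1.1 q.1.1 
      (congrArg (fun r : Wedge (L.M P1.gen) (L'.M P1.gen) => r.1.1) e)
    obtain ⟨l, hl⟩ := (h' x).2 p.1.2 q.1.2
      (congrArg (fun r : Wedge (L.M P1.gen) (L'.M P1.gen) => r.1.2) e)
    refine ⟨k + l, Wedge.ext ?_ ?_⟩
    · change coord x ^ (k + l) • p.1.1 = coord x ^ (k + l) • q.1.1
      rw [pow_add, mul_comm, mul_smul, mul_smul, hk]
    · change coord x ^ (k + l) • p.1.2 = coord x ^ (k + l) • q.1.2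
      rw [pow_add, mul_smul, mul_smul, hl]

theorem LMod.sum_normal {L L' : LMod} (h : L.Normal) (h' : L'.Normal) :
    (L.sum L').Normal := by
  intro x a (p : Wedge (L.M x) (L'.M x)) (q : Wedge (L.M x) (L'.M x)) e hne
  have e1 : a • p.1.1 = a • q.1.1 :=
    congrArg (fun r : Wedge (L.M x) (L'.M x) => r.1.1) e
  have e2 : a • p.1.2 = a • q.1.2 :=
    congrArg (fun r : Wedge (L.M x) (L'.M x) => r.1.2) e
  by_cases h1 : a • p.1.1 = 0
  · have h2 : a • p.1.2 ≠ 0 := fun h2 => hne (Wedge.ext h1 h2)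
    have hp : p.1.1 = 0 := p.2.resolve_right fun h0 => h2 (by rw [h0, smul_zero])
    have hq : q.1.1 = 0 := q.2.resolve_right fun h0 => h2 (by rw [e2, h0, smul_zero])
    exact Wedge.ext (hp.trans hq.symm) (h' x a _ _ e2 h2)
  · have hp : p.1.2 = 0 := p.2.resolve_left fun h0 => h1 (by rw [h0, smul_zero])
    have hq : q.1.2 = 0 := q.2.resolve_left fun h0 => h1 (by rw [e1, h0, smul_zero])
    exact Wedge.ext (h x a _ _ e1 h1) (hp.trans hq.symm)

/-- The direct sum of sheaves, glued from the direct sums of modules on the affine open sets. -/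
def NCoh.sum (F G : NCoh) : NCoh where
  mod := (F.mod.germs.sum G.mod.germs).glue
  coherent := LMod.glue_coherent _ (LMod.sum_fg F.coherent.1 G.coherent.1)
    (LMod.sum_qcoh F.coherent.2 G.coherent.2)
  normal := LMod.glue_normal _ (LMod.sum_normal F.normal G.normal)

/-! ## Line bundles, torsion sheaves and cyclic sheaves -/

/-- The monomial `t ^ k` as a function at the generic point. -/
def mono (k : ℤ) : Osec (nhd P1.gen) := Oconst P1.gen (t ^ k) trivial

/-- The transition function of `O(m)` at a point: `t ^ (-m)` at `0`, and `1` otherwise. -/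
def transition (m : ℤ) : P1 → Osec (nhd P1.gen)
  | P1.zero => mono (-m)
  | P1.infty => 1
  | P1.gen => 1

/-- The gluing data of the line bundle `O(m)`: the modules `⟨t⟩` on `U₀` and `⟨t⁻¹⟩` on `U_∞`
are glued along `t ^ k ↦ t ^ (k - m)`. -/
def lineData (m : ℤ) : LMod where
  M x := Osec (nhd x)
  act x := inferInstance
  toGen x a := transition m x * Ores (nhd_gen_le x) a
  toGen_gen a := one_mul a
  map_smul x a b := by
    rw [smul_eq_mul, smul_eq_mul, map_mul, mul_left_comm]

theorem t_ne_zero : t ≠ 0 := WithZero.coe_ne_zero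

theorem exists_eq_t_zpow {a : K} (ha : a ≠ 0) : ∃ k : ℤ, a = t ^ k := by
  obtain ⟨b, rfl⟩ := WithZero.ne_zero_iff_exists.mp ha
  refine ⟨Multiplicative.toAdd b, ?_⟩
  rw [t, ← WithZero.coe_zpow, ← ofAdd_zsmul]
  simp

theorem unif_ne_zero (x : P1) : unif x ≠ 0 := by
  cases x <;> simp [unif, t_ne_zero]

/-- Every element of `⟨t, t⁻¹⟩` becomes regular at `x` after multiplication with a power of the
local coordinate. -/
theorem exists_unif_pow_mul_mem (x : P1) (a : K) : ∃ k : ℕ, unif x ^ k * a ∈ stalk x := by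
  by_cases ha : a = 0
  · exact ⟨0, by simpa [ha] using zero_mem_stalk x⟩
  obtain ⟨k, rfl⟩ := exists_eq_t_zpow ha
  cases x
  · refine ⟨k.natAbs, Or.inr ⟨(k.natAbs + k).toNat, ?_⟩⟩
    rw [unif, ← zpow_natCast, ← zpow_natCast, ← zpow_add₀ t_ne_zero]
    congr 1
    omega
  · refine ⟨k.natAbs, Or.inr ⟨(k.natAbs - k).toNat, ?_⟩⟩
    rw [unif, ← zpow_natCast, ← zpow_natCast, inv_zpow', inv_zpow', ← zpow_add₀ t_ne_zero]
    congr 1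
    omega
  · exact ⟨0, trivial⟩

theorem transition_ne_zero (m : ℤ) (x : P1) : Oval P1.gen (transition m x) ≠ 0 := by
  cases x
  · exact zpow_ne_zero _ t_ne_zero
  · exact one_ne_zero
  · exact one_ne_zero

theorem lineData_fg (m : ℤ) : (lineData m).FG :=
  fun _ => ⟨{(1 : Osec _)}, Set.finite_singleton _, fun a => ⟨a, _, rfl, mul_one (M := Osec _) a⟩⟩

theorem lineData_qcoh (m : ℤ) : (lineData m).QCoh := by
  intro x
  constructor
  · intro (b : Osec (nhd P1.gen))
    obtain ⟨k, hk⟩ := exists_unif_pow_mul_mem x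
      ((Oval P1.gen (transition m x))⁻¹ * Oval P1.gen b)
    refine ⟨k, Oconst x _ hk, Oval_injective _ ?_⟩
    change Oval P1.gen (Ores (nhd_gen_le x) (coord x ^ k) * b) =
      Oval P1.gen (transition m x * Ores (nhd_gen_le x) (Oconst x _ hk))
    rw [map_mul, map_mul, Oval_res, Oval_res, map_pow]
    change unif x ^ k * _ = _ * (unif x ^ k * _)
    rw [mul_left_comm, mul_inv_cancel_left₀ (transition_ne_zero m x)]
  · intro (a : Osec (nhd x)) (b : Osec (nhd x)) e
    refine ⟨0, ?_⟩
    have e' : Oval P1.gen (transition m x * Ores (nhd_gen_le x) a) =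
      Oval P1.gen (transition m x * Ores (nhd_gen_le x) b) := congrArg _ e
    rw [map_mul, map_mul, Oval_res, Oval_res] at e'
    rw [Oval_injective x (mul_left_cancel₀ (transition_ne_zero m x) e')]

theorem lineData_normal (m : ℤ) : (lineData m).Normal := by
  intro x a (b : Osec (nhd x)) (c : Osec (nhd x)) e hne
  have e' : Oval x (a * b) = Oval x (a * c) := congrArg _ e
  rw [map_mul, map_mul] at e'
  refine Oval_injective x (mul_left_cancel₀ (fun h => hne ?_) e')
  change a * b = 0
  rw [Oval_injective x (h.trans (map_zero _).symm), zero_mul]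

/-- The line bundle `O(m)`. -/
def line (m : ℤ) : NCoh where
  mod := (lineData m).glue
  coherent := LMod.glue_coherent _ (lineData_fg m) (lineData_qcoh m)
  normal := LMod.glue_normal _ (lineData_normal m)

/-- The ideal of `O` that is `E_n = {0, u ^ n, u ^ (n + 1), …}` on the neighbourhood of `x` with
local coordinate `u`, and the unit ideal at the other points. -/
def torIdeal (x : P1) (n : ℕ) : LSub (lineData 0) where
  carrier y := {a : Osec (nhd y) | y = x → coord y ^ n ∣ a}
  zero_mem y := fun _ => dvd_zero _
  smul_mem y a m hm := fun h => Dvd.dvd.mul_left (hm h) a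
  toGen_mem y m hm := by
    rintro rfl
    have : coord P1.gen = 1 := rfl
    rw [this, one_pow]
    exact one_dvd _

/-- The torsion sheaf `T_{x,n}` at a closed point `x`: the module `⟨u⟩ / E_n` on the neighbourhood
of `x`, glued with the zero module. -/
def tor (x : P1) (n : ℕ+) : NCoh where
  mod := (torIdeal x n).quot.glue
  coherent := LMod.glue_coherent _ ((torIdeal x n).quot_fg (lineData_fg 0))
    ((torIdeal x n).quot_qcoh (lineData_qcoh 0) fun _ m _ =>
      ⟨n, fun _ => Dvd.intro m rfl⟩)
  normal := LMod.glue_normal _ ((torIdeal x n).quot_normal (lineData_normal 0))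

/-- The homomorphism from `⟨t, t⁻¹⟩` to `{0} ∪ ℤ/n` that sends `t ^ k` to the class of `k`. -/
def cycHom (n : ℕ+) : K →*₀ WithZero (Multiplicative (ZMod n)) :=
  WithZero.map' (AddMonoidHom.toMultiplicative (Int.castAddHom (ZMod n)))

/-- The gluing data of the cyclic sheaf `C_n`: at each point the module with elements `z_[i]`,
`[i] ∈ ℤ/n`, and `0`, where `t • z_[i] = z_[i+1]`. -/
def cycData (n : ℕ+) : LMod where
  M _ := WithZero (Multiplicative (ZMod n))
  act x := MulActionWithZero.compHom _ ((cycHom n).comp (Oval x))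
  toGen _ m := m
  toGen_gen _ := rfl
  map_smul x a m := by
    change cycHom n (Oval x a) * m = cycHom n (Oval P1.gen (Ores (nhd_gen_le x) a)) * m
    rw [Oval_res]

theorem cycData_fg (n : ℕ+) : (cycData n).FG := fun _ =>
  ⟨Set.univ, Set.toFinite (α := Option (ZMod n)) _, fun m => ⟨1, m, trivial, one_smul _ m⟩⟩

theorem cycData_qcoh (n : ℕ+) : (cycData n).QCoh := by
  intro x
  refine ⟨fun m => ⟨0, m, ?_⟩, fun m m' e => ⟨0, ?_⟩⟩
  · rw [pow_zero, map_one, one_smul]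
    rfl
  · obtain rfl : m = m' := e
    rfl

theorem cycData_normal (n : ℕ+) : (cycData n).Normal := by
  intro x a (m : WithZero (Multiplicative (ZMod n)))
    (m' : WithZero (Multiplicative (ZMod n))) e hne
  refine mul_left_cancel₀ (a := cycHom n (Oval x a)) (fun h => hne ?_) e
  change cycHom n (Oval x a) * _ = 0
  rw [h, zero_mul]

/-- The cyclic sheaf `C_n`. -/
def cyc (n : ℕ+) : NCoh where
  mod := (cycData n).glue
  coherent := LMod.glue_coherent _ (cycData_fg n) (cycData_qcoh n)
  normal := LMod.glue_normal _ (cycData_normal n)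

/-! ## Indecomposable sheaves and the Hall algebra -/

/-- Isomorphism of normal coherent sheaves. -/
instance NCoh.setoid : Setoid NCoh where
  r F G := Nonempty (OMod.Iso F.mod G.mod)
  iseqv := ⟨fun F => ⟨OMod.Iso.refl F.mod⟩, fun ⟨e⟩ => ⟨e.symm⟩, fun ⟨e⟩ ⟨e'⟩ => ⟨e.trans e'⟩⟩

/-- The zero sheaf: all sections are zero. -/
def NCoh.IsZero (F : NCoh) : Prop := ∀ (U : Opens P1) (s : F.mod.Sec U), s = 0

/-- A sheaf that is not isomorphic to a direct sum of two non-zero sheaves. -/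
def NCoh.Indecomposable (F : NCoh) : Prop :=
  ∀ G H : NCoh, F ≈ G.sum H → G.IsZero ∨ H.IsZero

/-- The isomorphism classes of normal coherent sheaves on `P¹`. -/
abbrev IsoCoh : Type 1 := Quotient NCoh.setoid

/-- The underlying space of the Hall algebra: the finitely supported complex functions on the set
of isomorphism classes. -/
abbrev Hall : Type 1 := IsoCoh →₀ ℂ

/-- The delta function of the isomorphism class of `F`. -/
def delta (F : NCoh) : Hall := Finsupp.single (Quotient.mk _ F) 1

/-- The summand of the convolution product of `f` and `g` at `F` that belongs to `F' ⊆ F`. -/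
def hallTerm (f g : Hall) (F : NCoh) (N : CohSub F.mod) : ℂ :=
  f (Quotient.mk _ N.quot) * g (Quotient.mk _ N.sub)

/-- `h` is the convolution product of `f` and `g` in the Hall algebra: for every sheaf `F`,
`h(F)` is the sum of `f(F/F') g(F')` over all coherent subsheaves `F'` of `F`, where only finitely
many summands do not vanish. -/
def IsHallProduct (f g h : Hall) : Prop :=
  ∀ F : NCoh, (Function.support (hallTerm f g F)).Finite ∧
    h (Quotient.mk _ F) = ∑ᶠ N : CohSub F.mod, hallTerm f g F N

end FunP1

end

noncomputable section

namespace FunP1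

/-! Every point of the projective line has a smallest open neighbourhood, and two different ones
meet only at the generic point. A sheaf is therefore the same as three modules with maps to the
generic one (`NCoh.equiv_iff`), and a coherent subsheaf is the same as a family of submodules that
is itself finitely generated and quasi-coherent. The value of a product of two delta functions at a
sheaf thus counts the families `P` with prescribed quotient `A` and subobject `B`
(`isHallProduct_of_isExt`). Each identity asks which normal `L` contain such a `P`, and why `P` is
unique.

Existence: over a monoid, `P` splits off as soon as its complement, together with `0`, is closed
under the operations (`iso_sum_of_complement`). This holds whenever the quotient is torsion free, so
line bundles and cyclic sheaves as quotients give only direct sums. For a quotient `T_{x,n}` with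
local coordinate `u`, lift a generator to `e`. Then `u ^ n e` lies in `P`. If it is zero, the
extension splits. Otherwise it is `u ^ j g` for the generator `g` of `P`; normality would cancel a
factor `u` if `j > 0`, contradicting the order `n` of `e` modulo `P`. So `u ^ n e = g`, and `e`
generates everything at `x` (`coord_pow_smul_eq`). This is the second term of the torsion products.

Uniqueness: if `L` is cyclic at `x`, the quotient `T_{x,n}` forces `P` to be generated there by `u ^
n e` (`eq_powSub`). If `L` is a direct sum of cyclic modules, a cyclic `P` with cyclic quotient is
at each point one of the two summands (`Compl.eq_or_eq`), and an invariant (degree, torsion, or the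
annihilating power of `u`) excludes the wrong one. For a cyclic sheaf the functions act transitively
on non-zero elements, so `P` contains that summand or meets it in zero; indecomposability rules out
the first case. -/

/-! ## Isomorphisms of gluing data -/

/-- Isomorphisms of gluing data. -/
structure LIso (L L' : LMod) where
  equiv : ∀ x, L.M x ≃ L'.M x
  map_smul : ∀ x (a : Osec (nhd x)) (m : L.M x), equiv x (a • m) = a • equiv x m
  map_toGen : ∀ x (m : L.M x), equiv P1.gen (L.toGen x m) = L'.toGen x (equiv x m)

namespace LIso

variable {L L' L'' : LMod}

def refl (L : LMod) : LIso L L := ⟨fun _ => Equiv.refl _, fun _ _ _ => rfl, fun _ _ => rfl⟩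

def symm (e : LIso L L') : LIso L' L where
  equiv x := (e.equiv x).symm
  map_smul x a m := by rw [Equiv.symm_apply_eq, e.map_smul, Equiv.apply_symm_apply]
  map_toGen x m := by rw [Equiv.symm_apply_eq, e.map_toGen, Equiv.apply_symm_apply]

def trans (e : LIso L L') (e' : LIso L' L'') : LIso L L'' where
  equiv x := (e.equiv x).trans (e'.equiv x)
  map_smul x a m := by simp [e.map_smul, e'.map_smul]
  map_toGen x m := by simp [e.map_toGen, e'.map_toGen]

theorem map_zero (e : LIso L L') (x : P1) : e.equiv x 0 = 0 := by
  have := e.map_smul x 0 0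
  rwa [zero_smul, zero_smul] at this

theorem map_eq_zero (e : LIso L L') (x : P1) {m : L.M x} : e.equiv x m = 0 ↔ m = 0 := by
  rw [← e.map_zero, (e.equiv x).apply_eq_iff_eq]

theorem fg (e : LIso L L') (h : L.FG) : L'.FG := by
  intro x
  obtain ⟨S, hS, hg⟩ := h x
  refine ⟨e.equiv x '' S, hS.image _, fun m => ?_⟩
  obtain ⟨a, s, hs, h⟩ := hg ((e.equiv x).symm m)
  exact ⟨a, _, ⟨s, hs, rfl⟩, by rw [← e.map_smul, h, Equiv.apply_symm_apply]⟩

theorem qcoh (e : LIso L L') (h : L.QCoh) : L'.QCoh := by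
  intro x
  refine ⟨fun m' => ?_, fun m m' hm => ?_⟩
  · obtain ⟨k, m, h⟩ := (h x).1 ((e.equiv _).symm m')
    exact ⟨k, e.equiv x m, by
      rw [← e.map_toGen, ← h, e.map_smul, Equiv.apply_symm_apply]⟩
  · obtain ⟨k, h⟩ := (h x).2 ((e.equiv x).symm m) ((e.equiv x).symm m') (by
      apply (e.equiv _).injective
      rw [e.map_toGen, e.map_toGen, Equiv.apply_symm_apply, Equiv.apply_symm_apply, hm])
    refine ⟨k, (e.equiv x).symm.injective ?_⟩
    exact (e.symm.map_smul x _ m).trans (h.trans (e.symm.map_smul x _ m').symm)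

def ofIso {F G : OMod} (e : OMod.Iso F G) : LIso F.germs G.germs where
  equiv x := e.equiv (nhd x)
  map_smul x := e.map_smul (nhd x)
  map_toGen x := e.map_res (nhd_gen_le x)

def germsGlue (L : LMod) : LIso L.glue.germs L where
  equiv := L.germEquiv
  map_smul := L.germEquiv_smul
  map_toGen := L.germEquiv_toGen

/-- Isomorphic gluing data give isomorphic sheaves. -/
def glue (e : LIso L L') : OMod.Iso L.glue L'.glue where
  equiv U :=
    { toFun := fun s : L.GlueSec U => (⟨fun x => e.equiv x (s.1 x), fun x hx => by
        rw [← e.map_toGen, s.2 x hx]⟩ : L'.GlueSec U)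
      invFun := fun s : L'.GlueSec U => (⟨fun x => (e.equiv x).symm (s.1 x), fun x hx => by
        rw [Equiv.eq_symm_apply, e.map_toGen, Equiv.apply_symm_apply, s.2 x hx]⟩ : L.GlueSec U)
      left_inv := fun s => Subtype.ext (funext fun x => (e.equiv x).symm_apply_apply _)
      right_inv := fun s => Subtype.ext (funext fun x => (e.equiv x).apply_symm_apply _) }
  map_smul U a s := Subtype.ext (funext fun x => e.map_smul x _ _)
  map_res h s := rfl

/-- Isomorphisms of the summands give an isomorphism of the direct sums. -/
def sum {M M' : LMod} (e : LIso L L') (f : LIso M M') : LIso (L.sum M) (L'.sum M') where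
  equiv x :=
    { toFun := fun p : Wedge (L.M x) (M.M x) =>
        (⟨(e.equiv x p.1.1, f.equiv x p.1.2), p.2.imp
          (fun h => (e.map_eq_zero x).2 h) (fun h => (f.map_eq_zero x).2 h)⟩ :
          Wedge (L'.M x) (M'.M x))
      invFun := fun p : Wedge (L'.M x) (M'.M x) =>
        (⟨((e.equiv x).symm p.1.1, (f.equiv x).symm p.1.2), p.2.imp
          (fun h => (e.symm.map_eq_zero x).2 h) (fun h => (f.symm.map_eq_zero x).2 h)⟩ :
          Wedge (L.M x) (M.M x))
      left_inv := fun p => Wedge.ext (by simp) (by simp)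
      right_inv := fun p => Wedge.ext (by simp) (by simp) }
  map_smul x a p := Wedge.ext (e.map_smul x a _) (f.map_smul x a _)
  map_toGen x p := Wedge.ext (e.map_toGen x _) (f.map_toGen x _)

/-- Direct sums are commutative. -/
def sumComm (L M : LMod) : LIso (L.sum M) (M.sum L) where
  equiv x :=
    { toFun := fun p : Wedge (L.M x) (M.M x) => (⟨p.1.swap, p.2.symm⟩ : Wedge (M.M x) (L.M x))
      invFun := fun p : Wedge (M.M x) (L.M x) => (⟨p.1.swap, p.2.symm⟩ : Wedge (L.M x) (M.M x))
      left_inv := fun _ => rfl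
      right_inv := fun _ => rfl }
  map_smul _ _ _ := rfl
  map_toGen _ _ := rfl

end LIso

/-! ### Sheaves are glued from their germs -/

namespace OMod

variable (F : OMod)

theorem le_iSup_nhd (U : Opens P1) : U ≤ ⨆ x : U, nhd x.1 := fun x hx =>
  Opens.mem_iSup.mpr ⟨⟨x, hx⟩, mem_nhd x⟩

/-- Two different smallest neighbourhoods share at most the generic point, so compatibility of
sections on an overlap needs to be checked only there. -/
theorem le_nhd_gen {V : Opens P1} {x y : P1} (hx : V ≤ nhd x) (hy : V ≤ nhd y) (hxy : x ≠ y) :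
    V ≤ nhd P1.gen := by
  intro z hz
  rcases hx hz with rfl | h
  · rcases hy hz with rfl | h
    · exact absurd rfl hxy
    · exact Or.inr h
  · exact Or.inr h

theorem eq_of_res_eq {U : Opens P1} {s s' : F.Sec U}
    (h : ∀ x (hx : x ∈ U), F.res (nhd_le hx) s = F.res (nhd_le hx) s') : s = s' :=
  F.sheaf.eq_of_locally_eq' (fun x : U => nhd x.1) U (fun x => homOfLE (nhd_le x.2))
    (le_iSup_nhd U) s s' fun x => h x.1 x.2

theorem exists_res_eq {U : Opens P1} (s : F.germs.GlueSec U) :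
    ∃ s' : F.Sec U, ∀ x : U, F.res (nhd_le x.2) s' = s.1 x := by
  obtain ⟨s', h, -⟩ := F.sheaf.existsUnique_gluing' (fun x : U => nhd x.1) U
    (fun x => homOfLE (nhd_le x.2)) (le_iSup_nhd U) s.1 (by
      intro x y
      change F.res _ (s.1 x) = F.res _ (s.1 y)
      by_cases hxy : x = y
      · subst hxy
        rfl
      have hV : nhd x.1 ⊓ nhd y.1 ≤ nhd P1.gen :=
        le_nhd_gen inf_le_left inf_le_right fun h => hxy (Subtype.ext h)
      have h : F.res (nhd_gen_le x.1) (s.1 x) = F.res (nhd_gen_le y.1) (s.1 y) :=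
        (s.2 x.1 x.2).trans (s.2 y.1 y.2).symm
      exact (F.res_res (nhd_gen_le x.1) hV (s.1 x)).symm.trans
        ((congrArg (F.res hV) h).trans (F.res_res (nhd_gen_le y.1) hV (s.1 y))))
  exact ⟨s', h⟩

/-- A sheaf is glued from its germs. -/
def isoGlue : OMod.Iso F F.germs.glue where
  equiv U := Equiv.ofBijective
    (fun s : F.Sec U => (⟨fun x => F.res (nhd_le x.2) s, fun x hx => F.res_res _ _ s⟩ :
      F.germs.GlueSec U))
    ⟨fun s s' h => F.eq_of_res_eq fun x hx => congrFun (congrArg Subtype.val h) ⟨x, hx⟩,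
      fun s => by
        obtain ⟨s', h⟩ := F.exists_res_eq s
        exact ⟨s', Subtype.ext (funext h)⟩⟩
  map_smul U a s := Subtype.ext (funext fun x => F.res_smul _ _ _)
  map_res h s := Subtype.ext (funext fun x => F.res_res _ _ _)

end OMod

/-- Since a sheaf is glued from its germs, an isomorphism of germs extends to all open sets. From
here on every question about isomorphism concerns three modules and their generization maps. -/
theorem NCoh.equiv_iff {F G : NCoh} : F ≈ G ↔ Nonempty (LIso F.mod.germs G.mod.germs) :=
  ⟨fun ⟨e⟩ => ⟨LIso.ofIso e⟩,
    fun ⟨e⟩ => ⟨(F.mod.isoGlue.trans e.glue).trans G.mod.isoGlue.symm⟩⟩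

theorem NCoh.equiv_iff_of_iso {F G : NCoh} {L : LMod} (e : LIso G.mod.germs L) :
    F ≈ G ↔ Nonempty (LIso F.mod.germs L) :=
  NCoh.equiv_iff.trans ⟨fun ⟨f⟩ => ⟨f.trans e⟩, fun ⟨f⟩ => ⟨f.trans e.symm⟩⟩

/-! ## Subsheaves and families of submodules -/

namespace LSub

variable {L : LMod}

theorem ext {P P' : LSub L} (h : ∀ x, P.carrier x = P'.carrier x) : P = P' := by
  cases P
  cases P'
  congr
  exact funext h

variable (P : LSub L)

instance (x : P1) : Zero (P.carrier x) := ⟨⟨0, P.zero_mem x⟩⟩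

instance (x : P1) : MulActionWithZero (Osec (nhd x)) (P.carrier x) where
  smul a m := ⟨a • m.1, P.smul_mem x a m.1 m.2⟩
  one_smul m := Subtype.ext (one_smul _ m.1)
  mul_smul a b m := Subtype.ext (mul_smul a b m.1)
  smul_zero a := Subtype.ext (smul_zero a)
  zero_smul m := Subtype.ext (zero_smul _ m.1)

/-- A family of submodules as gluing data. -/
def toLMod : LMod where
  M x := P.carrier x
  toGen x m := ⟨L.toGen x m.1, P.toGen_mem x m.1 m.2⟩
  toGen_gen m := Subtype.ext (L.toGen_gen m.1)
  map_smul x a m := Subtype.ext (L.map_smul x a m.1)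

theorem toLMod_normal (h : L.Normal) : P.toLMod.Normal := by
  intro x a m m' e hne
  exact Subtype.ext (h x a m.1 m'.1 (congrArg Subtype.val e) fun h0 => hne (Subtype.ext h0))

theorem proj_eq_zero (x : P1) (m : L.M x) : P.proj x m = 0 ↔ m ∈ P.carrier x := by
  rw [← P.proj_zero, P.proj_eq_iff]
  constructor
  · rintro (rfl | h)
    · exact P.zero_mem x
    · exact h.1
  · exact fun h => Or.inr ⟨h, P.zero_mem x⟩

variable {F : OMod}

/-- The subsheaf whose germs are a given family of submodules. -/
def toSubsheaf (P : LSub F.germs) : Subsheaf F where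
  carrier U := {s | ∀ x (hx : x ∈ U), F.res (nhd_le hx) s ∈ P.carrier x}
  zero_mem U _ _ := by
    rw [F.res_zero]
    exact P.zero_mem _
  smul_mem U a s hs x hx := by
    rw [F.res_smul]
    exact P.smul_mem x _ _ (hs x hx)
  res_mem h s hs x hx := by
    rw [F.res_res]
    exact hs x (h hx)
  local_mem U s hs x hx := by
    obtain ⟨V, h, hV, hs⟩ := hs x hx
    have := hs x hV
    rwa [F.res_res] at this

theorem mem_toSubsheaf_nhd (P : LSub F.germs) (x : P1) (m : F.Sec (nhd x)) :
    m ∈ P.toSubsheaf.carrier (nhd x) ↔ m ∈ P.carrier x := by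
  constructor
  · intro h
    have := h x (mem_nhd x)
    rwa [F.res_refl] at this
  · intro h y hy
    obtain rfl | rfl := hy
    · rwa [F.res_refl]
    · exact P.toGen_mem x m h

/-- The germs of the subsheaf with a given family of germs. -/
def germsToSubsheaf (P : LSub F.germs) : LIso P.toSubsheaf.toOMod.germs P.toLMod where
  equiv x := Equiv.subtypeEquivRight (P.mem_toSubsheaf_nhd x)
  map_smul _ _ _ := rfl
  map_toGen _ _ := rfl

end LSub

namespace CohSub

variable {F : NCoh}

/-- Membership in a subsheaf is a local condition, and the smallest neighbourhoods form the finest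
cover. -/
theorem lsub_injective : Function.Injective (CohSub.lsub : CohSub F.mod → LSub F.mod.germs) := by
  intro N N' h
  have key : ∀ (N : CohSub F.mod) U (s : F.mod.Sec U), s ∈ N.carrier U ↔
      ∀ x (hx : x ∈ U), F.mod.res (nhd_le hx) s ∈ N.lsub.carrier x := fun N U s =>
    ⟨fun hs x hx => N.res_mem _ s hs,
      fun hs => N.local_mem U s fun x hx => ⟨nhd x, nhd_le hx, mem_nhd x, hs x hx⟩⟩
  have : N.toSubsheaf = N'.toSubsheaf :=
    Subsheaf.ext (funext fun U => Set.ext fun s => by rw [key, key, h])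
  cases N
  cases N'
  congr

/-- Together with `lsub_injective` this turns the sum over coherent subsheaves into a count of
families of submodules. -/
theorem exists_lsub_eq (P : LSub F.mod.germs) (h : P.toLMod.FG) (h' : P.toLMod.QCoh) :
    ∃ N : CohSub F.mod, N.lsub = P :=
  ⟨⟨P.toSubsheaf, P.germsToSubsheaf.symm.fg h, P.germsToSubsheaf.symm.qcoh h'⟩,
    LSub.ext fun x => Set.ext fun m => P.mem_toSubsheaf_nhd x m⟩

def germsSub (N : CohSub F.mod) : LIso N.sub.mod.germs N.lsub.toLMod where
  equiv _ := Equiv.refl _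
  map_smul _ _ _ := rfl
  map_toGen _ _ := rfl

def germsQuot (N : CohSub F.mod) : LIso N.quot.mod.germs N.lsub.quot := LIso.germsGlue _

end CohSub

/-! ## A criterion for products of delta functions -/

/-- `P` exhibits `L` as an extension of `A` by `B`. -/
def IsExt (A B : LMod) {L : LMod} (P : LSub L) : Prop :=
  Nonempty (LIso P.quot A) ∧ Nonempty (LIso P.toLMod B)

theorem delta_apply (F G : NCoh) [Decidable (G ≈ F)] :
    delta F (Quotient.mk _ G) = if G ≈ F then 1 else 0 := by
  classical
  rw [delta, Finsupp.single_apply]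
  refine if_congr ?_ rfl rfl
  exact eq_comm.trans Quotient.eq

/-- Each summand of the convolution is the indicator of `IsExt`, so the product counts extensions.
Only the counts 0 and 1 occur in the theorem. Coherence of `P` need not be demanded, as it follows
from the isomorphism with `B'`. -/
theorem isHallProduct_of_isExt {A B : NCoh} {A' B' : LMod} (eA : LIso A.mod.germs A')
    (eB : LIso B.mod.germs B') {h : Hall}
    (H : ∀ F : NCoh,
      (h (Quotient.mk _ F) = 1 ∧ ∃! P : LSub F.mod.germs, IsExt A' B' P) ∨
      (h (Quotient.mk _ F) = 0 ∧ ∀ P : LSub F.mod.germs, ¬ IsExt A' B' P)) :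
    IsHallProduct (delta A) (delta B) h := by
  classical
  intro F
  have key : ∀ N : CohSub F.mod,
      hallTerm (delta A) (delta B) F N = if IsExt A' B' N.lsub then 1 else 0 := by
    intro N
    rw [hallTerm, delta_apply, delta_apply, ite_mul, one_mul, zero_mul, ← ite_and]
    refine if_congr (and_congr ?_ ?_) rfl rfl
    · rw [NCoh.equiv_iff_of_iso eA]
      exact ⟨fun ⟨e⟩ => ⟨N.germsQuot.symm.trans e⟩, fun ⟨e⟩ => ⟨N.germsQuot.trans e⟩⟩
    · rw [NCoh.equiv_iff_of_iso eB]
      exact ⟨fun ⟨e⟩ => ⟨N.germsSub.symm.trans e⟩, fun ⟨e⟩ => ⟨N.germsSub.trans e⟩⟩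
  rcases H F with ⟨h1, P, hP, hu⟩ | ⟨h0, hn⟩
  · obtain ⟨e⟩ := hP.2
    obtain ⟨N, rfl⟩ := CohSub.exists_lsub_eq P (e.symm.fg (eB.fg B.coherent.1))
      (e.symm.qcoh (eB.qcoh B.coherent.2))
    have hN : ∀ N', N' ≠ N → hallTerm (delta A) (delta B) F N' = 0 := fun N' hN' => by
      rw [key, if_neg fun h => hN' (CohSub.lsub_injective (hu _ h))]
    refine ⟨(Set.finite_singleton N).subset fun N' h => ?_, ?_⟩
    · by_contra hne
      exact h (hN N' hne)
    · rw [h1, finsum_eq_single _ N hN, key, if_pos hP]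
  · have : hallTerm (delta A) (delta B) F = 0 := funext fun N => by
      rw [key, if_neg (hn _)]
      rfl
    rw [this]
    refine ⟨by simp, ?_⟩
    rw [h0]
    simp

/-- The case of one extension. -/
theorem isHallProduct_single {A B C : NCoh} {A' B' C' : LMod} (eA : LIso A.mod.germs A')
    (eB : LIso B.mod.germs B') (eC : LIso C.mod.germs C')
    (h : ∀ L : LMod, L.Normal → ∀ P : LSub L, IsExt A' B' P → Nonempty (LIso L C'))
    (h' : ∀ L : LMod, LIso L C' → ∃! P : LSub L, IsExt A' B' P) :
    IsHallProduct (delta A) (delta B) (delta C) := by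
  classical
  refine isHallProduct_of_isExt eA eB fun F => ?_
  by_cases hF : F ≈ C
  · obtain ⟨e⟩ := (NCoh.equiv_iff_of_iso eC).1 hF
    exact Or.inl ⟨by rw [delta_apply, if_pos hF], h' _ e⟩
  · exact Or.inr ⟨by rw [delta_apply, if_neg hF], fun P hP =>
      hF ((NCoh.equiv_iff_of_iso eC).2 (h _ F.normal P hP))⟩

/-- The case of two extensions. -/
theorem isHallProduct_pair {A B C D : NCoh} {A' B' C' D' : LMod} (eA : LIso A.mod.germs A')
    (eB : LIso B.mod.germs B') (eC : LIso C.mod.germs C') (eD : LIso D.mod.germs D')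
    (hCD : LIso C' D' → False)
    (h : ∀ L : LMod, L.Normal → ∀ P : LSub L, IsExt A' B' P →
      Nonempty (LIso L C') ∨ Nonempty (LIso L D'))
    (hC : ∀ L : LMod, LIso L C' → ∃! P : LSub L, IsExt A' B' P)
    (hD : ∀ L : LMod, LIso L D' → ∃! P : LSub L, IsExt A' B' P) :
    IsHallProduct (delta A) (delta B) (delta C + delta D) := by
  classical
  refine isHallProduct_of_isExt eA eB fun F => ?_
  rw [Finsupp.add_apply, delta_apply, delta_apply]
  by_cases hFC : F ≈ C
  · obtain ⟨e⟩ := (NCoh.equiv_iff_of_iso eC).1 hFC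
    refine Or.inl ⟨?_, hC _ e⟩
    -- The value is 1 and not 2 because `hCD` keeps `F` from being isomorphic to both terms.
    rw [if_pos hFC, if_neg, add_zero]
    intro hFD
    obtain ⟨f⟩ := (NCoh.equiv_iff_of_iso eD).1 hFD
    exact hCD (e.symm.trans f)
  · by_cases hFD : F ≈ D
    · obtain ⟨e⟩ := (NCoh.equiv_iff_of_iso eD).1 hFD
      exact Or.inl ⟨by rw [if_neg hFC, if_pos hFD, zero_add], hD _ e⟩
    · refine Or.inr ⟨by rw [if_neg hFC, if_neg hFD, add_zero], fun P hP => ?_⟩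
      rcases h _ F.normal P hP with e | e
      · exact hFC ((NCoh.equiv_iff_of_iso eC).2 e)
      · exact hFD ((NCoh.equiv_iff_of_iso eD).2 e)

/-! ## Direct sum decompositions -/

/-- An isomorphism from compatible bijections. -/
def LIso.ofBijective {L L' : LMod} (f : ∀ x, L.M x → L'.M x) (hf : ∀ x, Function.Bijective (f x))
    (hs : ∀ x (a : Osec (nhd x)) (m : L.M x), f x (a • m) = a • f x m)
    (hg : ∀ x (m : L.M x), f P1.gen (L.toGen x m) = L'.toGen x (f x m)) : LIso L L' where
  equiv x := Equiv.ofBijective (f x) (hf x)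
  map_smul := hs
  map_toGen := hg

namespace LSub

variable {L A B : LMod}

/-- The gluing data `L` are the direct sum of the submodules `Q` and `R`. -/
structure Compl (Q R : LSub L) : Prop where
  mem_or_mem : ∀ x m, m ∈ Q.carrier x ∨ m ∈ R.carrier x
  eq_zero : ∀ x m, m ∈ Q.carrier x → m ∈ R.carrier x → m = 0

variable {P Q R : LSub L}

theorem Compl.symm (h : Compl Q R) : Compl R Q :=
  ⟨fun x m => (h.mem_or_mem x m).symm, fun x m hQ hR => h.eq_zero x m hR hQ⟩

open Classical in
/-- The sum of the two components. -/
def sumMap (Q R : LSub L) (x : P1) (p : Wedge (Q.carrier x) (R.carrier x)) : L.M x :=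
  if p.1.1 = 0 then p.1.2.1 else p.1.1.1

theorem sumMap_inl (x : P1) (m : Q.carrier x) : sumMap Q R x (Wedge.inl m) = m.1 := by
  unfold sumMap Wedge.inl
  split_ifs with h
  · simp only at h
    rw [h]
    rfl
  · rfl

theorem sumMap_inr (x : P1) (m : R.carrier x) : sumMap Q R x (Wedge.inr m) = m.1 :=
  if_pos rfl

/-- The direct sum of complementary submodules. -/
def Compl.isoSum (h : Compl Q R) : LIso (Q.toLMod.sum R.toLMod) L :=
  LIso.ofBijective (fun x => sumMap Q R x) (fun x => ⟨by
      intro (p : Wedge (Q.carrier x) (R.carrier x)) (q : Wedge (Q.carrier x) (R.carrier x)) e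
      obtain ⟨m, rfl⟩ | ⟨m, rfl⟩ := p.exists_eq <;> obtain ⟨m', rfl⟩ | ⟨m', rfl⟩ := q.exists_eq <;>
        simp only [sumMap_inl, sumMap_inr] at e
      · rw [Subtype.ext e]
      · rw [show m = 0 from Subtype.ext (h.eq_zero x _ m.2 (e ▸ m'.2)),
          show m' = 0 from Subtype.ext (h.eq_zero x _ (e ▸ m.2) m'.2)]
        rfl
      · rw [show m = 0 from Subtype.ext (h.eq_zero x _ (e ▸ m'.2) m.2),
          show m' = 0 from Subtype.ext (h.eq_zero x _ m'.2 (e ▸ m.2))]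
        rfl
      · rw [Subtype.ext e], by
      intro m
      rcases h.mem_or_mem x m with hm | hm
      · exact ⟨Wedge.inl ⟨m, hm⟩, sumMap_inl x _⟩
      · exact ⟨Wedge.inr ⟨m, hm⟩, sumMap_inr x _⟩⟩)
    (by
      intro x a (p : Wedge (Q.carrier x) (R.carrier x))
      obtain ⟨m, rfl⟩ | ⟨m, rfl⟩ := p.exists_eq
      · have : a • (Wedge.inl m : Wedge (Q.carrier x) (R.carrier x)) = Wedge.inl (a • m) :=
          Wedge.ext rfl (smul_zero a)
        exact (congrArg _ this).trans ((sumMap_inl x _).trans (congrArg _ (sumMap_inl x m).symm))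
      · have : a • (Wedge.inr m : Wedge (Q.carrier x) (R.carrier x)) = Wedge.inr (a • m) :=
          Wedge.ext (smul_zero a) rfl
        exact (congrArg _ this).trans ((sumMap_inr x _).trans (congrArg _ (sumMap_inr x m).symm)))
    (by
      intro x (p : Wedge (Q.carrier x) (R.carrier x))
      obtain ⟨m, rfl⟩ | ⟨m, rfl⟩ := p.exists_eq
      · have : (Q.toLMod.sum R.toLMod).toGen x (Wedge.inl m : Wedge (Q.carrier x) (R.carrier x)) =
            (Wedge.inl (Q.toLMod.toGen x m) : Wedge (Q.carrier _) (R.carrier _)) :=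
          Wedge.ext rfl (R.toLMod.toGen_zero x)
        exact (congrArg _ this).trans ((sumMap_inl _ _).trans (congrArg _ (sumMap_inl x m).symm))
      · have : (Q.toLMod.sum R.toLMod).toGen x (Wedge.inr m : Wedge (Q.carrier x) (R.carrier x)) =
            (Wedge.inr (R.toLMod.toGen x m) : Wedge (Q.carrier _) (R.carrier _)) :=
          Wedge.ext (Q.toLMod.toGen_zero x) rfl
        exact (congrArg _ this).trans ((sumMap_inr _ _).trans (congrArg _ (sumMap_inr x m).symm)))

/-- The quotient by a direct summand is the complementary summand. -/
def Compl.isoQuot (h : Compl Q R) : LIso Q.toLMod R.quot :=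
  LIso.ofBijective (fun x m => R.proj x m.1) (fun x => ⟨by
      intro m m' e
      rcases (R.proj_eq_iff x _ _).1 e with e | ⟨hm, hm'⟩
      · exact Subtype.ext e
      · exact Subtype.ext ((h.eq_zero x _ m.2 hm).trans (h.eq_zero x _ m'.2 hm').symm), by
      intro m
      obtain ⟨m, rfl⟩ := R.proj_surjective x m
      rcases h.mem_or_mem x m with hm | hm
      · exact ⟨⟨m, hm⟩, rfl⟩
      · exact ⟨⟨0, Q.zero_mem x⟩, ((R.proj_eq_zero x m).2 hm).symm⟩⟩)
    (fun _ _ _ => rfl) (fun _ _ => rfl)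

/-- The summands of a direct sum are complementary submodules. -/
theorem exists_compl_of_iso (e : LIso L (A.sum B)) : ∃ Q R : LSub L, Compl Q R ∧
    Nonempty (LIso Q.toLMod A) ∧ Nonempty (LIso R.toLMod B) := by
  -- The two components of `e`; each summand will be the zero set of the other component.
  let f (x : P1) (m : L.M x) : A.M x := (show Wedge (A.M x) (B.M x) from e.equiv x m).1.1
  let g (x : P1) (m : L.M x) : B.M x := (show Wedge (A.M x) (B.M x) from e.equiv x m).1.2
  have hfg x m : f x m = 0 ∨ g x m = 0 := (show Wedge (A.M x) (B.M x) from e.equiv x m).2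
  have hext x m m' (h : f x m = f x m') (h' : g x m = g x m') : m = m' :=
    (e.equiv x).injective (Wedge.ext h h')
  have hsurj x (p : Wedge (A.M x) (B.M x)) : ∃ m, f x m = p.1.1 ∧ g x m = p.1.2 := by
    obtain ⟨m, rfl⟩ := (e.equiv x).surjective p
    exact ⟨m, rfl, rfl⟩
  have f_smul x (a : Osec (nhd x)) m : f x (a • m) = a • f x m :=
    congrArg (fun p : Wedge (A.M x) (B.M x) => p.1.1) (e.map_smul x a m)
  have g_smul x (a : Osec (nhd x)) m : g x (a • m) = a • g x m :=
    congrArg (fun p : Wedge (A.M x) (B.M x) => p.1.2) (e.map_smul x a m)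
  have f_gen x m : f P1.gen (L.toGen x m) = A.toGen x (f x m) :=
    congrArg (fun p : Wedge (A.M P1.gen) (B.M P1.gen) => p.1.1) (e.map_toGen x m)
  have g_gen x m : g P1.gen (L.toGen x m) = B.toGen x (g x m) :=
    congrArg (fun p : Wedge (A.M P1.gen) (B.M P1.gen) => p.1.2) (e.map_toGen x m)
  have f_zero x : f x 0 = 0 := by
    have := f_smul x 0 0
    rwa [zero_smul, zero_smul] at this
  have g_zero x : g x 0 = 0 := by
    have := g_smul x 0 0
    rwa [zero_smul, zero_smul] at this
  let Q : LSub L :=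
    { carrier := fun x => {m | g x m = 0}
      zero_mem := g_zero
      smul_mem := fun x a m (hm : g x m = 0) => by
        change g x (a • m) = 0
        rw [g_smul, hm, smul_zero]
      toGen_mem := fun x m (hm : g x m = 0) => by
        change g _ (L.toGen x m) = 0
        rw [g_gen, hm, B.toGen_zero] }
  let R : LSub L :=
    { carrier := fun x => {m | f x m = 0}
      zero_mem := f_zero
      smul_mem := fun x a m (hm : f x m = 0) => by
        change f x (a • m) = 0
        rw [f_smul, hm, smul_zero]
      toGen_mem := fun x m (hm : f x m = 0) => by
        change f _ (L.toGen x m) = 0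
        rw [f_gen, hm, A.toGen_zero] }
  refine ⟨Q, R, ⟨fun x m => (hfg x m).symm, fun x m hQ hR =>
    hext x m 0 (hR.trans (f_zero x).symm) (hQ.trans (g_zero x).symm)⟩,
    ⟨LIso.ofBijective (fun x m => f x m.1) (fun x => ⟨?_, ?_⟩) (fun x a m => f_smul x a m.1)
      (fun x m => f_gen x m.1)⟩,
    ⟨LIso.ofBijective (fun x m => g x m.1) (fun x => ⟨?_, ?_⟩) (fun x a m => g_smul x a m.1)
      (fun x m => g_gen x m.1)⟩⟩
  · intro m m' h
    exact Subtype.ext (hext x _ _ h (Eq.trans m.2 (Eq.symm m'.2)))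
  · intro a
    obtain ⟨m, h, h'⟩ := hsurj x (Wedge.inl a)
    exact ⟨⟨m, h'⟩, h⟩
  · intro m m' h
    exact Subtype.ext (hext x _ _ (Eq.trans m.2 (Eq.symm m'.2)) h)
  · intro a
    obtain ⟨m, h, h'⟩ := hsurj x (Wedge.inr a)
    exact ⟨⟨m, h⟩, h'⟩

/-- A direct sum is an extension. -/
theorem Compl.isExt (h : Compl Q R) (eQ : LIso Q.toLMod A) (eR : LIso R.toLMod B) :
    IsExt A B R := ⟨⟨h.isoQuot.symm.trans eQ⟩, ⟨eR⟩⟩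

/-- Uniqueness of a subobject has to be checked only for the summand of a direct sum. -/
theorem existsUnique_isExt (e : LIso L (A.sum B))
    (H : ∀ P Q R : LSub L, IsExt A B P → Compl Q R → Nonempty (LIso Q.toLMod A) →
      Nonempty (LIso R.toLMod B) → P = R) : ∃! P : LSub L, IsExt A B P := by
  obtain ⟨Q, R, h, ⟨eQ⟩, ⟨eR⟩⟩ := exists_compl_of_iso e
  exact ⟨R, h.isExt eQ eR, fun P hP => H P Q R hP h ⟨eQ⟩ ⟨eR⟩⟩

/-- A submodule splits off if its complement is closed under the operations. -/
theorem iso_sum_of_complement (hP : IsExt A B P)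
    (h : ∀ x (a : Osec (nhd x)) m, m ∉ P.carrier x → a • m ∈ P.carrier x → a • m = 0)
    (h' : ∀ x m, m ∉ P.carrier x → L.toGen x m ∈ P.carrier P1.gen → L.toGen x m = 0) :
    Nonempty (LIso L (A.sum B)) := by
  -- The only candidate for a complement of `P`: the set-theoretic complement with `0` added.
  let Q : LSub L :=
    { carrier := fun x => {m | m = 0 ∨ m ∉ P.carrier x}
      zero_mem := fun x => Or.inl rfl
      smul_mem := by
        rintro x a m (rfl | hm)
        · exact Or.inl (smul_zero a)
        · exact or_iff_not_imp_right.2 fun h0 => h x a m hm (not_not.1 h0)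
      toGen_mem := by
        rintro x m (rfl | hm)
        · exact Or.inl (L.toGen_zero x)
        · exact or_iff_not_imp_right.2 fun h0 => h' x m hm (not_not.1 h0) }
  have hc : Compl Q P := by
    refine ⟨fun x m => ?_, fun x m hQ hm => hQ.resolve_right fun h0 => h0 hm⟩
    by_cases hm : m ∈ P.carrier x
    · exact Or.inr hm
    · exact Or.inl (Or.inr hm)
  obtain ⟨⟨eA⟩, ⟨eB⟩⟩ := hP
  exact ⟨hc.isoSum.symm.trans ((hc.isoQuot.trans eA).sum eB)⟩

end LSub

/-! ## Invariants of gluing data -/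

namespace LMod

/-- The module at `x` is zero. -/
def ZeroAt (L : LMod) (x : P1) : Prop := ∀ m : L.M x, m = 0

/-- The module at `x` is generated by one element. -/
def CyclicAt (L : LMod) (x : P1) : Prop := ∃ e : L.M x, ∀ m, ∃ a : Osec (nhd x), a • e = m

/-- The modules have no torsion. -/
structure TorsionFree (L : LMod) : Prop where
  smul : ∀ x (a : Osec (nhd x)) (m : L.M x), a • m = 0 → a = 0 ∨ m = 0
  toGen : ∀ x (m : L.M x), L.toGen x m = 0 → m = 0

/-- The `k`-th power of the local coordinate at `x` acts as zero. -/
def KilledAt (L : LMod) (x : P1) (k : ℕ) : Prop := ∀ m : L.M x, coord x ^ k • m = 0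

end LMod

namespace LIso

variable {L L' : LMod}

theorem zeroAt (e : LIso L L') {x : P1} (h : L.ZeroAt x) : L'.ZeroAt x := fun _ =>
  (e.symm.map_eq_zero x).1 (h _)

theorem cyclicAt (e : LIso L L') {x : P1} (h : L.CyclicAt x) : L'.CyclicAt x := by
  obtain ⟨g, hg⟩ := h
  refine ⟨e.equiv x g, fun m => ?_⟩
  obtain ⟨a, ha⟩ := hg ((e.equiv x).symm m)
  exact ⟨a, by rw [← e.map_smul, ha, Equiv.apply_symm_apply]⟩

theorem torsionFree (e : LIso L L') (h : L.TorsionFree) : L'.TorsionFree := by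
  refine ⟨fun x a m hm => ?_, fun x m hm => ?_⟩
  · rw [← e.symm.map_eq_zero] at hm ⊢
    exact h.smul x a _ ((e.symm.map_smul x a m).symm.trans hm)
  · rw [← e.symm.map_eq_zero] at hm ⊢
    exact h.toGen x _ ((e.symm.map_toGen x m).symm.trans hm)

theorem killedAt (e : LIso L L') {x : P1} {k : ℕ} (h : L.KilledAt x k) : L'.KilledAt x k := by
  intro m
  rw [← e.symm.map_eq_zero]
  exact (e.symm.map_smul x _ m).trans (h _)

end LIso

/-! ### Submodules of direct sums -/

namespace LSub

variable {L A B : LMod} {P Q R : LSub L}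

theorem zeroAt_iff (P : LSub L) (x : P1) : P.toLMod.ZeroAt x ↔ P.carrier x = {0} := by
  constructor
  · intro h
    refine Set.eq_singleton_iff_unique_mem.2 ⟨P.zero_mem x, fun m hm => ?_⟩
    exact congrArg Subtype.val (h ⟨m, hm⟩)
  · intro h m
    have : m.1 ∈ ({0} : Set (L.M x)) := h ▸ m.2
    exact Subtype.ext this

theorem quot_zeroAt_iff (P : LSub L) (x : P1) :
    P.quot.ZeroAt x ↔ ∀ m, m ∈ P.carrier x := by
  constructor
  · exact fun h m => (P.proj_eq_zero x m).1 (h _)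
  · intro h m
    obtain ⟨m, rfl⟩ := P.proj_surjective x m
    exact (P.proj_eq_zero x m).2 (h m)

/-- An extension of torsion free gluing data splits. -/
theorem iso_sum_of_torsionFree (hP : IsExt A B P) (hA : A.TorsionFree) :
    Nonempty (LIso L (A.sum B)) := by
  obtain ⟨e⟩ := hP.1
  -- Torsion freeness of `L / P` says that nothing outside `P` is carried into `P` by a non-zero
  -- function or by passing to the generic point.
  have ht := e.symm.torsionFree hA
  refine iso_sum_of_complement hP (fun x a m hm h => ?_) (fun x m hm h => ?_)
  · rw [← P.proj_eq_zero, P.proj_smul] at h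
    rcases ht.smul x a _ h with rfl | h
    · exact zero_smul _ m
    · exact absurd ((P.proj_eq_zero x m).1 h) hm
  · rw [← P.proj_eq_zero, P.proj_toGen] at h
    exact absurd ((P.proj_eq_zero x m).1 (ht.toGen x _ h)) hm

/-- A lift `e` of a generator of the quotient lies in one summand. An element of the other summand
is in `P` or a multiple of `e`, and in the latter case it lies in both summands and vanishes. -/
theorem Compl.le_or_le_of_quot (h : Compl Q R) (P : LSub L) {x : P1} (hc : P.quot.CyclicAt x) :
    Q.carrier x ⊆ P.carrier x ∨ R.carrier x ⊆ P.carrier x := by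
  obtain ⟨e, he⟩ := hc
  obtain ⟨e, rfl⟩ := P.proj_surjective x e
  have key : ∀ {Q R : LSub L}, Compl Q R → e ∈ Q.carrier x → R.carrier x ⊆ P.carrier x := by
    intro Q R h hQ m hm
    obtain ⟨a, ha⟩ := he (P.proj x m)
    rw [← P.proj_smul, P.proj_eq_iff] at ha
    rcases ha with rfl | ha
    · rw [h.eq_zero x _ (Q.smul_mem x a e hQ) hm]
      exact P.zero_mem x
    · exact ha.2
  rcases h.mem_or_mem x e with hQ | hR
  · exact Or.inr (key h hQ)
  · exact Or.inl (key h.symm hR)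

/-- The summand that contains a generator of `P` contains all its multiples. -/
theorem Compl.le_or_le_of_sub (h : Compl Q R) (P : LSub L) {x : P1} (hc : P.toLMod.CyclicAt x) :
    P.carrier x ⊆ Q.carrier x ∨ P.carrier x ⊆ R.carrier x := by
  obtain ⟨e, he⟩ := hc
  have key : ∀ Q : LSub L, e.1 ∈ Q.carrier x → P.carrier x ⊆ Q.carrier x := by
    intro Q hQ m hm
    obtain ⟨a, ha⟩ := he ⟨m, hm⟩
    rw [← show a • e.1 = m from congrArg Subtype.val ha]
    exact Q.smul_mem x a _ hQ
  exact (h.mem_or_mem x e.1).imp (key Q) (key R)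

/-- A submodule of a direct sum of cyclic modules with the right subobject and quotient is one of
the summands. -/
theorem Compl.eq_or_eq (h : Compl Q R) (eQ : LIso Q.toLMod A) (eR : LIso R.toLMod B)
    (hP : IsExt A B P) {x : P1} (hA : A.CyclicAt x) (hB : B.CyclicAt x) :
    P.carrier x = Q.carrier x ∨ P.carrier x = R.carrier x := by
  obtain ⟨⟨eA⟩, ⟨eB⟩⟩ := hP
  rcases h.le_or_le_of_quot P (eA.symm.cyclicAt hA) with h1 | h1 <;>
    rcases h.le_or_le_of_sub P (eB.symm.cyclicAt hB) with h2 | h2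
  · exact Or.inl (h2.antisymm h1)
  -- Here `Q ⊆ P ⊆ R` forces `Q`, hence `A` and the quotient by `P`, to vanish at `x`; so `P` is
  -- everything.
  · refine Or.inr (h2.antisymm fun m _ => ?_)
    have hQ : Q.toLMod.ZeroAt x := fun m =>
      Subtype.ext (h.eq_zero x _ m.2 (h2 (h1 m.2)))
    exact (P.quot_zeroAt_iff x).1 ((eQ.trans eA.symm).zeroAt hQ) m
  -- Here `R ⊆ P ⊆ Q` forces `R`, hence `B` and `P`, to vanish at `x`.
  · have hR : R.toLMod.ZeroAt x := fun m =>
      Subtype.ext (h.eq_zero x _ (h2 (h1 m.2)) m.2)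
    refine Or.inr ?_
    rw [(R.zeroAt_iff x).1 hR, (P.zeroAt_iff x).1 ((eR.trans eB.symm).zeroAt hR)]
  · exact Or.inr (h2.antisymm h1)

/-- Where `A` vanishes both submodules are everything, and where `B` vanishes both are zero. -/
theorem Compl.eq_of_zeroAt (h : Compl Q R) (eQ : LIso Q.toLMod A) (eR : LIso R.toLMod B)
    (hP : IsExt A B P) {x : P1} (h0 : A.ZeroAt x ∨ B.ZeroAt x) :
    P.carrier x = R.carrier x := by
  obtain ⟨⟨eA⟩, ⟨eB⟩⟩ := hP
  rcases h0 with h0 | h0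
  · have hQ := (Q.zeroAt_iff x).1 (eQ.symm.zeroAt h0)
    refine Set.ext fun m => iff_of_true ((P.quot_zeroAt_iff x).1 (eA.symm.zeroAt h0) m) ?_
    refine (h.mem_or_mem x m).elim (fun hm => ?_) id
    rw [hQ, Set.mem_singleton_iff] at hm
    rw [hm]
    exact R.zero_mem x
  · rw [(R.zeroAt_iff x).1 (eR.symm.zeroAt h0), (P.zeroAt_iff x).1 (eB.symm.zeroAt h0)]

theorem killedAt_iff (P : LSub L) (x : P1) (k : ℕ) :
    P.toLMod.KilledAt x k ↔ ∀ m ∈ P.carrier x, coord x ^ k • m = 0 := by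
  constructor
  · intro h m hm
    have := h ⟨m, hm⟩
    exact congrArg Subtype.val this
  · exact fun h m => Subtype.ext (h m.1 m.2)

/-- A cyclic module is not a direct sum of two non-zero modules. -/
theorem not_cyclicAt_sum {x : P1} (hA : ¬ A.ZeroAt x) (hB : ¬ B.ZeroAt x) (e : LIso L (A.sum B))
    (hL : L.CyclicAt x) : False := by
  obtain ⟨Q, R, h, ⟨eQ⟩, ⟨eR⟩⟩ := exists_compl_of_iso e
  obtain ⟨g, hg⟩ := hL
  have key : ∀ {Q R : LSub L}, Compl Q R → g ∈ Q.carrier x → R.toLMod.ZeroAt x := by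
    intro Q R h hQ m
    obtain ⟨a, ha⟩ := hg m.1
    have ha' : m.1 ∈ Q.carrier x := by
      rw [← ha]
      exact Q.smul_mem x a g hQ
    exact Subtype.ext (h.eq_zero x _ ha' m.2)
  rcases h.mem_or_mem x g with hQ | hR
  · exact hB (eR.zeroAt (key h hQ))
  · exact hA (eQ.zeroAt (key h.symm hR))

end LSub

/-! ## The functions on the smallest neighbourhoods -/

instance (x : P1) : NoZeroDivisors (Osec (nhd x)) where
  eq_zero_or_eq_zero_of_mul_eq_zero {a b} h := by
    have : Oval x a * Oval x b = 0 := by rw [← map_mul, h, map_zero]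
    exact (mul_eq_zero.1 this).imp (fun h => Oval_injective x (h.trans (map_zero _).symm))
      (fun h => Oval_injective x (h.trans (map_zero _).symm))

instance (x : P1) : Nontrivial (Osec (nhd x)) :=
  ⟨0, 1, fun h => zero_ne_one (α := K) (by
    rw [← map_zero (Oval x), h, map_one])⟩

theorem Oval_coord (x : P1) : Oval x (coord x) = unif x := rfl

theorem Oval_mono (k : ℤ) : Oval P1.gen (mono k) = t ^ k := rfl

theorem coord_ne_zero (x : P1) : coord x ≠ 0 := fun h =>
  unif_ne_zero x (by rw [← Oval_coord, h, map_zero])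

theorem coord_pow_ne_zero (x : P1) (k : ℕ) : coord x ^ k ≠ 0 := pow_ne_zero k (coord_ne_zero x)

theorem Osec_mul_left_cancel {x : P1} {a b c : Osec (nhd x)} (ha : a ≠ 0) (h : a * b = a * c) :
    b = c := by
  refine Oval_injective x (mul_left_cancel₀ (a := Oval x a) (fun h0 => ha ?_) ?_)
  · exact Oval_injective x (h0.trans (map_zero _).symm)
  · rw [← map_mul, h, map_mul]

/-- This reduces computations at a closed point to comparing exponents, and makes divisibility a
total order there. -/
theorem eq_coord_pow {x : P1} (hx : x ≠ P1.gen) {a : Osec (nhd x)} (ha : a ≠ 0) :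
    ∃ k : ℕ, a = coord x ^ k := by
  have h : Oval x a = 0 ∨ ∃ k : ℕ, Oval x a = unif x ^ k := by
    have := a.2.2 ⟨x, mem_nhd x⟩
    cases x
    · exact this
    · exact this
    · exact absurd rfl hx
  rcases h with h | ⟨k, h⟩
  · exact absurd (Oval_injective x (h.trans (map_zero _).symm)) ha
  · exact ⟨k, Oval_injective x (by rw [h, map_pow, Oval_coord])⟩

theorem eq_mono {a : Osec (nhd P1.gen)} (ha : a ≠ 0) : ∃ k : ℤ, a = mono k := by
  obtain ⟨k, hk⟩ := exists_eq_t_zpow (a := Oval P1.gen a) fun h =>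
    ha (Oval_injective _ (h.trans (map_zero _).symm))
  exact ⟨k, Oval_injective _ hk⟩

theorem mono_add (k l : ℤ) : mono (k + l) = mono k * mono l :=
  Oval_injective _ (by rw [map_mul, Oval_mono, Oval_mono, Oval_mono, zpow_add₀ t_ne_zero])

theorem mono_zero : mono 0 = 1 :=
  Oval_injective _ (by rw [Oval_mono, zpow_zero, map_one])

theorem mono_ne_zero (k : ℤ) : mono k ≠ 0 := fun h =>
  zpow_ne_zero k t_ne_zero (by rw [← Oval_mono, h, map_zero])

theorem t_zpow_injective : Function.Injective fun k : ℤ => t ^ k := by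
  intro k l h
  have h' := WithZero.coe_injective (by simpa only [t, WithZero.coe_zpow] using h :
    ((Multiplicative.ofAdd (1 : ℤ) ^ k : Multiplicative ℤ) : K) =
      ((Multiplicative.ofAdd (1 : ℤ) ^ l : Multiplicative ℤ) : K))
  simpa [← ofAdd_zsmul] using h'

theorem mono_injective : Function.Injective mono := fun _ _ h =>
  t_zpow_injective (congrArg (Oval P1.gen) h)

/-- The exponent of the local coordinate as a power of `t`. -/
def unifExp : P1 → ℤ
  | P1.zero => 1
  | P1.infty => -1
  | P1.gen => 0

theorem unif_eq (x : P1) : unif x = t ^ unifExp x := by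
  cases x <;> simp [unif, unifExp]

theorem unifExp_ne_zero {x : P1} (hx : x ≠ P1.gen) : unifExp x ≠ 0 := by
  cases x <;> simp_all [unifExp]

theorem Ores_coord_pow (x : P1) (k : ℕ) :
    Ores (nhd_gen_le x) (coord x ^ k) = mono (unifExp x * k) := by
  refine Oval_injective _ ?_
  rw [Oval_res, map_pow, Oval_coord, Oval_mono, unif_eq, zpow_mul, zpow_natCast]

theorem coord_pow_injective {x : P1} (hx : x ≠ P1.gen) :
    Function.Injective fun k : ℕ => coord x ^ k := by
  intro k l h
  have := congrArg (Ores (nhd_gen_le x)) h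
  simp only [Ores_coord_pow] at this
  exact_mod_cast mul_left_cancel₀ (unifExp_ne_zero hx) (mono_injective this)

theorem coord_pow_dvd_iff {x : P1} (hx : x ≠ P1.gen) {k l : ℕ} :
    coord x ^ k ∣ coord x ^ l ↔ k ≤ l := by
  refine ⟨fun ⟨b, hb⟩ => ?_, pow_dvd_pow _⟩
  have hb0 : b ≠ 0 := by
    rintro rfl
    exact coord_pow_ne_zero x l (by rw [hb, mul_zero])
  obtain ⟨j, rfl⟩ := eq_coord_pow hx hb0
  rw [← pow_add] at hb
  have := coord_pow_injective hx hb
  omega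

/-- A closed point has no functions that are units other than `1`. -/
theorem eq_one_of_mul_eq_one {x : P1} (hx : x ≠ P1.gen) {a b : Osec (nhd x)} (h : a * b = 1) :
    a = 1 := by
  have ha : a ≠ 0 := by
    rintro rfl
    rw [zero_mul] at h
    exact zero_ne_one h
  obtain ⟨k, rfl⟩ := eq_coord_pow hx ha
  have := (coord_pow_dvd_iff hx (l := 0)).1 ⟨b, by rw [h, pow_zero]⟩
  rw [Nat.le_zero.1 this, pow_zero]

namespace LMod

variable {L : LMod}

/-- Monomials are units at the generic point. -/
theorem mono_smul_cancel (k : ℤ) {m m' : L.M P1.gen} (h : mono k • m = mono k • m') : m = m' := by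
  have := congrArg (fun m => mono (-k) • m) h
  simpa only [← mul_smul, ← mono_add, neg_add_cancel, mono_zero, one_smul] using this

theorem toGen_coord_pow_smul (x : P1) (k : ℕ) (m : L.M x) :
    L.toGen x (coord x ^ k • m) = mono (unifExp x * k) • L.toGen x m := by
  rw [L.map_smul, Ores_coord_pow]

/-- The local coordinate becomes a unit at the generic point, so whatever its powers annihilate dies
there. -/
theorem toGen_eq_zero_of_smul {x : P1} {k : ℕ} {m : L.M x} (h : coord x ^ k • m = 0) :
    L.toGen x m = 0 := by
  refine mono_smul_cancel (unifExp x * k) ?_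
  rw [← toGen_coord_pow_smul, h, L.toGen_zero, smul_zero]

end LMod

/-! ## Cyclic modules -/

/-- Gluing data with cyclic modules are determined by the relations between the generators. -/
theorem exists_iso_of_generators {L L' : LMod} (e : ∀ x, L.M x) (e' : ∀ x, L'.M x)
    (c : P1 → Osec (nhd P1.gen))
    (he : ∀ x m, ∃ a : Osec (nhd x), a • e x = m) (he' : ∀ x m, ∃ a : Osec (nhd x), a • e' x = m)
    (hr : ∀ x (a b : Osec (nhd x)), a • e x = b • e x ↔ a • e' x = b • e' x)
    (hc : ∀ x, L.toGen x (e x) = c x • e P1.gen)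
    (hc' : ∀ x, L'.toGen x (e' x) = c x • e' P1.gen) : Nonempty (LIso L L') := by
  choose f hf using he
  -- `f` chooses a coefficient for each element; by `hr` the image of `a • e x` does not depend on
  -- the choice.
  have key : ∀ x (a : Osec (nhd x)), f x (a • e x) • e' x = a • e' x := fun x a =>
    (hr x _ _).1 (hf x _)
  refine ⟨LIso.ofBijective (fun x m => f x m • e' x) (fun x => ⟨fun m m' h => ?_, fun m => ?_⟩)
    (fun x a m => ?_) (fun x m => ?_)⟩
  · rw [← hf x m, ← hf x m']
    exact (hr x _ _).2 h
  · obtain ⟨a, rfl⟩ := he' x m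
    exact ⟨a • e x, key x a⟩
  · obtain ⟨b, rfl⟩ : ∃ b : Osec (nhd x), b • e x = m := ⟨_, hf x m⟩
    rw [← mul_smul, key, key, mul_smul]
  · obtain ⟨b, rfl⟩ : ∃ b : Osec (nhd x), b • e x = m := ⟨_, hf x m⟩
    rw [L.map_smul, hc, ← mul_smul, key, key, L'.map_smul, hc', ← mul_smul]

/-! ## Line bundles -/

/-- `e` is a family of free generators of the modules, glued by `t ^ c`. -/
structure IsFrame (L : LMod) (e : ∀ x, L.M x) (c : P1 → ℤ) : Prop where
  generates : ∀ x m, ∃ a : Osec (nhd x), a • e x = m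
  free : ∀ x (a b : Osec (nhd x)), a • e x = b • e x → a = b
  glue : ∀ x, L.toGen x (e x) = mono (c x) • e P1.gen

theorem isFrame_lineData (m : ℤ) : IsFrame (lineData m) (fun x => (1 : Osec (nhd x)))
    (fun | P1.zero => -m | P1.infty => 0 | P1.gen => 0) where
  generates x a := ⟨a, mul_one (M := Osec (nhd x)) a⟩
  free x a b h := by
    change a * 1 = b * 1 at h
    rwa [mul_one, mul_one] at h
  glue x := by
    change transition m x * Ores (nhd_gen_le x) 1 = mono _ * 1
    rw [map_one, mul_one, mul_one]
    cases x
    · rfl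
    · exact mono_zero.symm
    · exact mono_zero.symm

namespace IsFrame

variable {L L' : LMod} {e : ∀ x, L.M x} {c : P1 → ℤ}

theorem map (h : IsFrame L e c) (φ : LIso L L') : IsFrame L' (fun x => φ.equiv x (e x)) c where
  generates x m := by
    obtain ⟨a, ha⟩ := h.generates x ((φ.equiv x).symm m)
    exact ⟨a, by rw [← φ.map_smul, ha, Equiv.apply_symm_apply]⟩
  free x a b hab := by
    rw [← φ.map_smul, ← φ.map_smul] at hab
    exact h.free x a b ((φ.equiv x).injective hab)
  glue x := by rw [← φ.map_toGen, h.glue, φ.map_smul]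

/-- Rescaling the generic generator by `t ^ c(∞)` makes the gluing at `∞` trivial and leaves the
exponent `c(0) - c(∞)` at `0`, which is minus the degree. -/
theorem nonempty_iso (h : IsFrame L e c) :
    Nonempty (LIso L (lineData (c P1.infty - c P1.zero))) := by
  let e₁ : ∀ x, L.M x := fun
    | P1.zero => e P1.zero
    | P1.infty => e P1.infty
    | P1.gen => mono (c P1.infty) • e P1.gen
  have h' := isFrame_lineData (c P1.infty - c P1.zero)
  refine exists_iso_of_generators e₁ (fun x => (1 : Osec (nhd x))) _ (fun x m => ?_) h'.generates
    (fun x a b => ⟨fun hab => ?_, fun hab => by rw [h'.free x a b hab]⟩) (fun x => ?_) h'.glue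
  · cases x
    · exact h.generates _ m
    · exact h.generates _ m
    · obtain ⟨a, rfl⟩ := h.generates _ m
      refine ⟨a * mono (-c P1.infty), ?_⟩
      change (a * mono (-c P1.infty)) • mono (c P1.infty) • e P1.gen = _
      rw [← mul_smul, mul_assoc, ← mono_add, neg_add_cancel, mono_zero, mul_one]
  · suffices a = b by rw [this]
    cases x
    · exact h.free _ a b hab
    · exact h.free _ a b hab
    · change a • mono (c P1.infty) • e P1.gen = b • mono (c P1.infty) • e P1.gen at hab
      rw [← mul_smul, ← mul_smul] at hab
      have := h.free _ _ _ hab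
      rw [mul_comm, mul_comm b] at this
      exact Osec_mul_left_cancel (mono_ne_zero _) this
  · cases x
    · change L.toGen _ (e P1.zero) = mono _ • mono (c P1.infty) • e P1.gen
      rw [h.glue, ← mul_smul, ← mono_add]
      congr 2
      ring
    · change L.toGen _ (e P1.infty) = mono _ • mono (c P1.infty) • e P1.gen
      rw [h.glue, ← mul_smul, ← mono_add]
      congr 2
      ring
    · change L.toGen P1.gen (mono (c P1.infty) • e P1.gen) = mono 0 • mono (c P1.infty) • e P1.gen
      rw [L.toGen_gen, mono_zero, one_smul]

theorem iso_of_eq (h : IsFrame L e c) {k : ℤ} (hk : c P1.infty - c P1.zero = k) :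
    Nonempty (LIso L (lineData k)) := hk ▸ h.nonempty_iso

/-- The only unit at a closed point is `1`, so two frames agree at both closed points. At the
generic point they differ by a monomial, which shifts both exponents by the same amount. -/
theorem degree_eq (h : IsFrame L e c) {e' : ∀ x, L.M x} {c' : P1 → ℤ} (h' : IsFrame L e' c') :
    c P1.infty - c P1.zero = c' P1.infty - c' P1.zero := by
  have he : ∀ x, x ≠ P1.gen → e' x = e x := by
    intro x hx
    obtain ⟨a, ha⟩ := h.generates x (e' x)
    obtain ⟨b, hb⟩ := h'.generates x (e x)
    rw [← ha, ← mul_smul] at hb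
    have hba := h.free x _ 1 (hb.trans (one_smul _ _).symm)
    rw [← ha, eq_one_of_mul_eq_one hx ((mul_comm a b).trans hba), one_smul]
  obtain ⟨a, ha⟩ := h.generates P1.gen (e' P1.gen)
  have ha0 : a ≠ 0 := by
    rintro rfl
    rw [zero_smul] at ha
    exact zero_ne_one (h'.free P1.gen 0 1 (by rw [← ha, smul_zero, smul_zero]))
  obtain ⟨k, rfl⟩ := eq_mono ha0
  have hc : ∀ x, x ≠ P1.gen → c x = c' x + k := by
    intro x hx
    have h1 := h'.glue x
    rw [he x hx, h.glue, ← ha, ← mul_smul, ← mono_add] at h1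
    exact mono_injective (h.free _ _ _ h1)
  rw [hc P1.infty (by simp), hc P1.zero (by simp)]
  ring

end IsFrame

theorem lineData_torsionFree (m : ℤ) : (lineData m).TorsionFree where
  smul _ _ _ h := eq_zero_or_eq_zero_of_mul_eq_zero h
  toGen x a h := by
    have h : transition m x * Ores (nhd_gen_le x) a = 0 := h
    rcases eq_zero_or_eq_zero_of_mul_eq_zero h with h | h
    · exact absurd (by rw [h, map_zero]) (transition_ne_zero m x)
    · refine Oval_injective x ((Oval_res x a).symm.trans ?_)
      rw [h, map_zero]
      exact (map_zero (Oval x)).symm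

theorem lineData_cyclicAt (m : ℤ) (x : P1) : (lineData m).CyclicAt x :=
  ⟨_, (isFrame_lineData m).generates x⟩

theorem lineData_not_zeroAt (m : ℤ) (x : P1) : ¬ (lineData m).ZeroAt x := fun h =>
  one_ne_zero (α := Osec (nhd x)) (h (1 : Osec (nhd x)))

/-- The degree of a line bundle is determined by its isomorphism class. -/
theorem eq_of_lineData_iso {n m : ℤ} (e : LIso (lineData n) (lineData m)) : n = m := by
  have := ((isFrame_lineData n).map e).degree_eq (isFrame_lineData m)
  simpa using this

/-! ## Torsion sheaves -/

/-- The gluing data of the torsion sheaf `T_{x,n}`. -/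
abbrev torData (x : P1) (n : ℕ) : LMod := (torIdeal x n).quot

/-- The generators of a torsion sheaf. -/
def torGen (x : P1) (n : ℕ) (y : P1) : (torData x n).M y :=
  (torIdeal x n).proj y (1 : Osec (nhd y))

theorem smul_torGen (x : P1) (n : ℕ) (y : P1) (a : Osec (nhd y)) :
    a • torGen x n y = (torIdeal x n).proj y a :=
  congrArg ((torIdeal x n).proj y) (mul_one a)

theorem torGen_generates (x : P1) (n : ℕ) (y : P1) (m : (torData x n).M y) :
    ∃ a : Osec (nhd y), a • torGen x n y = m := by
  obtain ⟨a, rfl⟩ := (torIdeal x n).proj_surjective y m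
  exact ⟨a, smul_torGen x n y a⟩

theorem torGen_smul_eq_iff (x : P1) (n : ℕ) (y : P1) (a b : Osec (nhd y)) :
    a • torGen x n y = b • torGen x n y ↔
      a = b ∨ (y = x → coord y ^ n ∣ a) ∧ (y = x → coord y ^ n ∣ b) := by
  rw [smul_torGen, smul_torGen]
  exact (torIdeal x n).proj_eq_iff y a b

theorem torGen_smul_eq_zero_iff (x : P1) (n : ℕ) (a : Osec (nhd x)) :
    a • torGen x n x = 0 ↔ coord x ^ n ∣ a := by
  rw [smul_torGen]
  exact ((torIdeal x n).proj_eq_zero x a).trans ⟨fun h => h rfl, fun h _ => h⟩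

theorem torData_zeroAt {x : P1} {n : ℕ} {y : P1} (hy : y ≠ x) : (torData x n).ZeroAt y :=
  ((torIdeal x n).quot_zeroAt_iff y).2 fun _ h => absurd h hy

theorem torData_cyclicAt (x : P1) (n : ℕ) (y : P1) : (torData x n).CyclicAt y :=
  ⟨_, torGen_generates x n y⟩

/-- The length `n` is thereby an isomorphism invariant; everything is decided on the generator. -/
theorem torData_killedAt_iff {x : P1} (hx : x ≠ P1.gen) {n k : ℕ} :
    (torData x n).KilledAt x k ↔ n ≤ k := by
  rw [← coord_pow_dvd_iff hx, ← torGen_smul_eq_zero_iff]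
  refine ⟨fun h => h _, fun h m => ?_⟩
  obtain ⟨a, rfl⟩ := torGen_generates x n x m
  rw [← mul_smul, mul_comm, mul_smul, h, smul_zero]

theorem torData_not_zeroAt {x : P1} (hx : x ≠ P1.gen) (n : ℕ+) : ¬ (torData x n).ZeroAt x :=
  fun h => by
    have := (torData_killedAt_iff hx (n := n) (k := 0)).1 fun m => h _
    exact n.pos.ne' (Nat.le_zero.1 this)

theorem torData_toGen {x : P1} (hx : x ≠ P1.gen) {n : ℕ} {y : P1} (m : (torData x n).M y) :
    (torData x n).toGen y m = 0 :=
  torData_zeroAt hx.symm _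

/-- A module generated by `e` with `u ^ n e = 0` and `u ^ k e ≠ 0` for `k < n`. -/
theorem exists_torData_iso {L : LMod} {x : P1} (hx : x ≠ P1.gen) {n : ℕ}
    (h0 : ∀ y, y ≠ x → L.ZeroAt y) {e : L.M x} (he : ∀ m, ∃ a : Osec (nhd x), a • e = m)
    (hn : coord x ^ n • e = 0) (hk : ∀ k < n, coord x ^ k • e ≠ 0) :
    Nonempty (LIso L (torData x n)) := by
  classical
  have hdvd : ∀ a : Osec (nhd x), coord x ^ n ∣ a → a • e = 0 := by
    rintro _ ⟨b, rfl⟩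
    rw [mul_comm, mul_smul, hn, smul_zero]
  -- If `k < l < n`, multiplication by `u ^ (n - l)` turns `u ^ k e = u ^ l e` into the vanishing of
  -- a power of `u` on `e` with exponent below `n`.
  have hpow : ∀ k l : ℕ, k < n → coord x ^ k • e = coord x ^ l • e → l ≤ k := by
    intro k l hkn h
    by_contra! hkl
    by_cases hl : n ≤ l
    · exact hk k hkn (h.trans (hdvd _ (pow_dvd_pow _ hl)))
    · have h' := congrArg (fun m => coord x ^ (n - l) • m) h
      simp only [← mul_smul, ← pow_add] at h'
      rw [Nat.sub_add_cancel (by omega), hn] at h'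
      exact hk _ (by omega) h'
  have hrel : ∀ a b : Osec (nhd x), a • e = b • e ↔
      a = b ∨ (x = x → coord x ^ n ∣ a) ∧ (x = x → coord x ^ n ∣ b) := by
    intro a b
    simp only [forall_const]
    constructor
    · intro h
      have haux : ∀ a : Osec (nhd x), a • e = 0 → coord x ^ n ∣ a := by
        intro a ha
        by_cases ha0 : a = 0
        · rw [ha0]
          exact dvd_zero _
        obtain ⟨k, rfl⟩ := eq_coord_pow hx ha0
        exact pow_dvd_pow _ (not_lt.1 fun hkn => hk k hkn ha)
      by_cases ha : coord x ^ n ∣ a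
      · exact Or.inr ⟨ha, haux b (h.symm.trans (hdvd a ha))⟩
      by_cases hb : coord x ^ n ∣ b
      · exact absurd (haux a (h.trans (hdvd b hb))) ha
      obtain ⟨k, rfl⟩ := eq_coord_pow hx (a := a) fun h => ha (h ▸ dvd_zero _)
      obtain ⟨l, rfl⟩ := eq_coord_pow hx (a := b) fun h => hb (h ▸ dvd_zero _)
      rw [coord_pow_dvd_iff hx, not_le] at ha hb
      rw [(hpow k l ha h).antisymm (hpow l k hb h.symm)]
      exact Or.inl rfl
    · rintro (rfl | ⟨ha, hb⟩)
      · rfl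
      · rw [hdvd a ha, hdvd b hb]
  -- Away from `x` both modules vanish, so `0` is a generator there; the generic module is one of
  -- these, so the transition functions may be `0` too.
  refine exists_iso_of_generators (fun y => if h : y = x then h ▸ e else 0) (torGen x n)
    (fun _ => 0) (fun y m => ?_) (torGen_generates x n) (fun y a b => ?_) (fun y => ?_) fun y => ?_
  · by_cases hy : y = x
    · subst hy
      simpa using he m
    · exact ⟨0, (h0 y hy _).trans (h0 y hy m).symm⟩
  · rw [torGen_smul_eq_iff]
    by_cases hy : y = x
    · subst hy
      simpa using hrel a b
    · exact iff_of_true ((h0 y hy _).trans (h0 y hy _).symm)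
        (Or.inr ⟨fun h => absurd h hy, fun h => absurd h hy⟩)
  · exact (h0 _ hx.symm _).trans (h0 _ hx.symm _).symm
  · rw [torData_toGen hx, zero_smul]

/-- The germs of a direct sum of sheaves. -/
def LIso.germsSum {F G : NCoh} {A B : LMod} (e : LIso F.mod.germs A) (f : LIso G.mod.germs B) :
    LIso (F.sum G).mod.germs (A.sum B) :=
  (LIso.germsGlue _).trans (e.sum f)

/-- The module at `x` is torsion. -/
def LMod.TorsionAt (L : LMod) (x : P1) : Prop := ∀ m : L.M x, L.toGen x m = 0

theorem LIso.torsionAt {L L' : LMod} (e : LIso L L') {x : P1} (h : L.TorsionAt x) :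
    L'.TorsionAt x := by
  intro m
  rw [← e.symm.map_eq_zero]
  exact (e.symm.map_toGen x m).trans (h _)

/-- Used to exclude that `P` is the wrong summand when one of `A`, `B` is torsion and the other is a
line bundle. -/
theorem LSub.zeroAt_of_torsionAt {L : LMod} {P Q : LSub L} {x : P1}
    (h : P.carrier x = Q.carrier x) (hP : P.toLMod.TorsionAt x) (hQ : Q.toLMod.TorsionFree) :
    Q.toLMod.ZeroAt x := by
  intro m
  have h0 := hP ⟨m.1, Set.mem_of_mem_of_subset m.2 h.ge⟩
  have h1 : L.toGen x m.1 = 0 := congrArg Subtype.val h0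
  exact hQ.toGen x m (Subtype.ext h1)

/-! ## Products of line bundles -/

/-- The choice between the two summands is the same at all points, since a torsion free summand
embeds in its generic module. Choosing `Q` everywhere would identify line bundles of different
degrees. -/
theorem line_mul_line {n m : ℤ} (hnm : m ≠ n) :
    IsHallProduct (delta (line n)) (delta (line m)) (delta ((line n).sum (line m))) := by
  refine isHallProduct_single (.germsGlue _) (.germsGlue _) (.germsSum (.germsGlue _) (.germsGlue _))
    (fun L _ P hP => LSub.iso_sum_of_torsionFree hP (lineData_torsionFree n))
    fun L e => LSub.existsUnique_isExt e ?_
  rintro P Q R hP hc ⟨eQ⟩ ⟨eR⟩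
  have heq : ∀ x, P.carrier x = Q.carrier x ∨ P.carrier x = R.carrier x := fun x =>
    hc.eq_or_eq eQ eR hP (lineData_cyclicAt n x) (lineData_cyclicAt m x)
  -- If `P` were `Q` at `x` and `R` generically, the image of `Q` at the generic point would lie in
  -- both summands and vanish, although `Q` is non-zero and torsion free.
  have key : ∀ {Q R : LSub L} {k : ℤ}, LSub.Compl Q R → LIso Q.toLMod (lineData k) →
      ∀ x, P.carrier x = Q.carrier x → P.carrier P1.gen ≠ R.carrier P1.gen := by
    intro Q R k hc eQ x hQ hR
    refine lineData_not_zeroAt k x (eQ.zeroAt fun q => ?_)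
    have hq : L.toGen x q.1 ∈ P.carrier P1.gen :=
      P.toGen_mem x _ (Set.mem_of_mem_of_subset q.2 hQ.ge)
    rw [hR] at hq
    exact (eQ.symm.torsionFree (lineData_torsionFree k)).toGen x q
      (Subtype.ext (hc.eq_zero _ _ (Q.toGen_mem x _ q.2) hq))
  rcases heq P1.gen with h | h
  · have hPQ : P = Q := LSub.ext fun x =>
      (heq x).resolve_right fun hx => key hc.symm eR x hx h
    subst hPQ
    obtain ⟨eB⟩ := hP.2
    exact absurd (eq_of_lineData_iso (eB.symm.trans eQ)) hnm
  · exact LSub.ext fun x => (heq x).resolve_left fun hx => key hc eQ x hx h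

theorem line_mul_tor {x : P1} (n : ℕ+) (m : ℤ) (hx : x ≠ P1.gen) :
    IsHallProduct (delta (line m)) (delta (tor x n)) (delta ((tor x n).sum (line m))) := by
  refine isHallProduct_single (A' := lineData m) (B' := torData x n)
    (C' := (torData x n).sum (lineData m)) (.germsGlue _) (.germsGlue _)
    (.germsSum (.germsGlue _) (.germsGlue _)) (fun L _ P hP => ?_) fun L e => ?_
  · obtain ⟨e⟩ := LSub.iso_sum_of_torsionFree hP (lineData_torsionFree m)
    exact ⟨e.trans (.sumComm _ _)⟩
  · refine LSub.existsUnique_isExt (e.trans (.sumComm _ _)) ?_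
    rintro P Q R hP hc ⟨eQ⟩ ⟨eR⟩
    refine LSub.ext fun y => (hc.eq_or_eq eQ eR hP (lineData_cyclicAt m y)
      (torData_cyclicAt x n y)).resolve_left fun h => ?_
    obtain ⟨eB⟩ := hP.2
    exact lineData_not_zeroAt m y (eQ.zeroAt (LSub.zeroAt_of_torsionAt h
      (eB.symm.torsionAt (torData_toGen hx)) (eQ.symm.torsionFree (lineData_torsionFree m))))

/-! ## Extensions of torsion sheaves -/

theorem LMod.coord_pow_smul_smul {L : LMod} (x : P1) (k l : ℕ) (m : L.M x) :
    coord x ^ k • coord x ^ l • m = coord x ^ (k + l) • m := by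
  rw [← mul_smul, ← pow_add]

section TorsionQuotient

variable {L : LMod} {x : P1} {n : ℕ}

theorem coord_pow_smul_mem (hx : x ≠ P1.gen) {P : LSub L} (φ : LIso P.quot (torData x n))
    (m : L.M x) : coord x ^ n • m ∈ P.carrier x := by
  rw [← P.proj_eq_zero, P.proj_smul]
  exact φ.symm.killedAt ((torData_killedAt_iff hx).2 le_rfl) _

/-- The powers of the local coordinate up to `n` do not annihilate a generator. -/
theorem le_of_coord_pow_smul_mem (hx : x ≠ P1.gen) {P : LSub L} (φ : LIso P.quot (torData x n))
    {e : L.M x} (he : ∀ m, m ∈ P.carrier x ∨ ∃ a : Osec (nhd x), a • e = m) {k : ℕ}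
    (hk : coord x ^ k • e ∈ P.carrier x) : n ≤ k := by
  refine (torData_killedAt_iff hx).1 (φ.killedAt fun m => ?_)
  obtain ⟨m, rfl⟩ := P.proj_surjective x m
  rw [← P.proj_smul, P.proj_eq_zero]
  rcases he m with hm | ⟨a, rfl⟩
  · exact P.smul_mem x _ m hm
  · rw [← mul_smul, mul_comm, mul_smul]
    exact P.smul_mem x _ _ hk

/-- Collapsing `P` identifies nothing outside `P`: a multiple of `e` with the same class as `m`
equals `m`, unless `m` lies in `P`. -/
theorem exists_lift_generator (P : LSub L) (φ : LIso P.quot (torData x n)) :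
    ∃ e : L.M x, ∀ m, m ∈ P.carrier x ∨ ∃ a : Osec (nhd x), a • e = m := by
  obtain ⟨e, he⟩ := φ.symm.cyclicAt (torData_cyclicAt x n x)
  obtain ⟨e, rfl⟩ := P.proj_surjective x e
  refine ⟨e, fun m => ?_⟩
  obtain ⟨a, ha⟩ := he (P.proj x m)
  rw [← P.proj_smul, P.proj_eq_iff] at ha
  exact ha.symm.imp And.right fun h => ⟨a, h⟩

/-- In a normal module the lift of a generator of the quotient generates a direct summand or
everything. -/
theorem coord_pow_smul_eq (hx : x ≠ P1.gen) (hL : L.Normal) (hn : 0 < n) {P : LSub L}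
    (φ : LIso P.quot (torData x n)) {e : L.M x}
    (he : ∀ m, m ∈ P.carrier x ∨ ∃ a : Osec (nhd x), a • e = m) {g : L.M x}
    (hg : g ∈ P.carrier x) (hgen : ∀ m ∈ P.carrier x, ∃ a : Osec (nhd x), a • g = m) :
    coord x ^ n • e = 0 ∨ coord x ^ n • e = g := by
  refine or_iff_not_imp_left.2 fun h0 => ?_
  obtain ⟨a, ha⟩ := hgen _ (coord_pow_smul_mem hx φ e)
  obtain ⟨j, rfl⟩ := eq_coord_pow hx (a := a) (by
    rintro rfl
    exact h0 (by rw [← ha, zero_smul]))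
  obtain ⟨n, rfl⟩ := Nat.exists_eq_succ_of_ne_zero hn.ne'
  cases j with
  | zero => rw [← ha, pow_zero, one_smul]
  | succ j =>
    -- The order is now `n + 1`. Normality cancels one factor `u`, which puts `u ^ n e` into `P`,
    -- against the order of `e` modulo `P`.
    have h1 : coord x • coord x ^ n • e = coord x • coord x ^ j • g := by
      rw [← mul_smul, ← mul_smul, ← pow_succ', ← pow_succ', ha]
    have h2 := hL x _ _ _ h1 (by rwa [← mul_smul, ← pow_succ'])
    have h3 := le_of_coord_pow_smul_mem hx φ he (k := n) (by
      rw [h2]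
      exact P.smul_mem x _ g hg)
    omega

theorem mem_of_ne {P : LSub L} (φ : LIso P.quot (torData x n)) {y : P1} (hy : y ≠ x)
    (m : L.M y) : m ∈ P.carrier y :=
  (P.quot_zeroAt_iff y).1 (φ.symm.zeroAt (torData_zeroAt hy)) m

/-- A multiple of `e` that lies in `P` is divisible by `u ^ n` and hence zero, so the complement of
`P` is closed at `x`. At other points `P` is everything, and all multiples of `e` die at the generic
point. -/
theorem iso_sum_of_smul_eq_zero (hx : x ≠ P1.gen) {B : LMod} {P : LSub L}
    (hP : IsExt (torData x n) B P) {e : L.M x}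
    (he : ∀ m, m ∈ P.carrier x ∨ ∃ a : Osec (nhd x), a • e = m) (h0 : coord x ^ n • e = 0) :
    Nonempty (LIso L ((torData x n).sum B)) := by
  obtain ⟨φ⟩ := hP.1
  have key : ∀ a : Osec (nhd x), a • e ∈ P.carrier x → a • e = 0 := by
    intro a ha
    by_cases ha0 : a = 0
    · rw [ha0, zero_smul]
    obtain ⟨k, rfl⟩ := eq_coord_pow hx ha0
    obtain ⟨l, rfl⟩ := Nat.exists_eq_add_of_le (le_of_coord_pow_smul_mem hx φ he ha)
    rw [add_comm, ← LMod.coord_pow_smul_smul, h0, smul_zero]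
  refine LSub.iso_sum_of_complement hP (fun y a m hm h => ?_) (fun y m hm _ => ?_)
  · by_cases hy : y = x
    · subst hy
      obtain ⟨b, rfl⟩ := (he m).resolve_left hm
      rw [← mul_smul] at h ⊢
      exact key _ h
    · exact absurd (mem_of_ne φ hy m) hm
  · by_cases hy : y = x
    · subst hy
      obtain ⟨b, rfl⟩ := (he m).resolve_left hm
      refine LMod.toGen_eq_zero_of_smul (k := n) ?_
      rw [← mul_smul, mul_comm, mul_smul, h0, smul_zero]
    · exact absurd (mem_of_ne φ hy m) hm

/-- The generator `g` of `P` is a multiple of `e`, and what lies outside `P` is a multiple of `e`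
already. -/
theorem generates_of_smul_eq {P : LSub L} {e g : L.M x}
    (he : ∀ m, m ∈ P.carrier x ∨ ∃ a : Osec (nhd x), a • e = m)
    (hgen : ∀ m ∈ P.carrier x, ∃ a : Osec (nhd x), a • g = m) (hg : coord x ^ n • e = g) (m : L.M x) :
    ∃ a : Osec (nhd x), a • e = m := by
  rcases he m with hm | hm
  · obtain ⟨a, rfl⟩ := hgen m hm
    exact ⟨a * coord x ^ n, by rw [mul_smul, hg]⟩
  · exact hm

/-! ## The subsheaf generated by a power of the local coordinate -/

/-- The submodule generated by `u ^ n e` at `x`, and everything elsewhere. -/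
def powSub (hx : x ≠ P1.gen) (n : ℕ) (e : ∀ y, L.M y) : LSub L where
  carrier y := {m | y = x → ∃ a : Osec (nhd y), a • coord y ^ n • e y = m}
  zero_mem y _ := ⟨0, zero_smul _ _⟩
  smul_mem y a m hm hy := by
    obtain ⟨b, rfl⟩ := hm hy
    exact ⟨a * b, mul_smul _ _ _⟩
  toGen_mem _ _ _ h := absurd h.symm hx

variable {e : ∀ y, L.M y}

theorem mem_powSub {hx : x ≠ P1.gen} {m : L.M x} :
    m ∈ (powSub hx n e).carrier x ↔ ∃ a : Osec (nhd x), a • coord x ^ n • e x = m :=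
  ⟨fun h => h rfl, fun h _ => h⟩

theorem mem_powSub_of_ne {hx : x ≠ P1.gen} {y : P1} (hy : y ≠ x) (m : L.M y) :
    m ∈ (powSub hx n e).carrier y := fun h => absurd h hy

/-- The quotient alone determines `P`: `u ^ k e` lies in `P` exactly when `n ≤ k`. -/
theorem eq_powSub (hx : x ≠ P1.gen) (he : ∀ m, ∃ a : Osec (nhd x), a • e x = m) {P : LSub L}
    (φ : LIso P.quot (torData x n)) : P = powSub hx n e := by
  refine LSub.ext fun y => Set.ext fun m => ?_
  by_cases hy : y = x
  · subst hy
    rw [mem_powSub]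
    constructor
    · intro hm
      obtain ⟨a, rfl⟩ := he m
      by_cases ha : a = 0
      · exact ⟨0, by rw [ha, zero_smul, zero_smul]⟩
      obtain ⟨k, rfl⟩ := eq_coord_pow hx ha
      obtain ⟨l, rfl⟩ := Nat.exists_eq_add_of_le
        (le_of_coord_pow_smul_mem hx φ (fun m => Or.inr (he m)) hm)
      exact ⟨coord y ^ l, by rw [LMod.coord_pow_smul_smul, add_comm]⟩
    · rintro ⟨a, rfl⟩
      exact P.smul_mem _ _ _ (coord_pow_smul_mem hx φ _)
  · exact iff_of_true (mem_of_ne φ hy m) (mem_powSub_of_ne hy m)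

/-- The condition `hk` excludes that a smaller power of `u` already carries `e` into the submodule,
so that the quotient has length exactly `n`. -/
theorem existsUnique_isExt_of_powSub (hx : x ≠ P1.gen) {B : LMod}
    (he : ∀ m, ∃ a : Osec (nhd x), a • e x = m)
    (hk : ∀ k : ℕ, coord x ^ k • e x ∈ (powSub hx n e).carrier x → n ≤ k)
    (hB : Nonempty (LIso (powSub hx n e).toLMod B)) :
    ∃! P : LSub L, IsExt (torData x n) B P := by
  refine ⟨powSub hx n e, ⟨?_, hB⟩, fun P hP => hP.1.elim fun φ => eq_powSub hx he φ⟩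
  refine exists_torData_iso hx (e := (powSub hx n e).proj x (e x)) (fun y hy => ?_) (fun m => ?_) ?_
    fun k hkn h => ?_
  · exact (LSub.quot_zeroAt_iff _ y).2 (mem_powSub_of_ne hy)
  · obtain ⟨m, rfl⟩ := (powSub hx n e).proj_surjective x m
    obtain ⟨a, rfl⟩ := he m
    exact ⟨a, rfl⟩
  · rw [← LSub.proj_smul, LSub.proj_eq_zero, mem_powSub]
    exact ⟨1, one_smul _ _⟩
  · rw [← LSub.proj_smul, LSub.proj_eq_zero] at h
    exact absurd (hk k h) (not_le.2 hkn)

end TorsionQuotient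

/-! ### Products of torsion sheaves with line bundles -/

open Classical in
/-- A line bundle as an extension of a torsion sheaf. -/
theorem exists_iso_line_of_smul_eq {L : LMod} {x : P1} {n : ℕ} {m : ℤ} (hx : x ≠ P1.gen)
    {P : LSub L} (φ : LIso P.quot (torData x n)) {g : ∀ y, P.toLMod.M y} {c : P1 → ℤ}
    (hg : IsFrame P.toLMod g c) (hc : c P1.infty - c P1.zero = m) {e : L.M x}
    (he : ∀ m, m ∈ P.carrier x ∨ ∃ a : Osec (nhd x), a • e = m)
    (h : coord x ^ n • e = (g x).1) : Nonempty (LIso L (lineData (n + m))) := by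
  have hgen : ∀ y, ∀ m ∈ P.carrier y, ∃ a : Osec (nhd y), a • (g y).1 = m := by
    intro y m hm
    obtain ⟨a, ha⟩ := hg.generates y ⟨m, hm⟩
    exact ⟨a, congrArg Subtype.val ha⟩
  have hfree : ∀ y (a b : Osec (nhd y)), a • (g y).1 = b • (g y).1 → a = b :=
    fun y a b hab => hg.free y a b (Subtype.ext hab)
  have hglue : ∀ y, L.toGen y (g y).1 = mono (c y) • (g P1.gen).1 :=
    fun y => congrArg Subtype.val (hg.glue y)
  -- As `u ^ n e` is the old generator at `x`, replacing that generator by `e` subtracts the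
  -- exponent of `u ^ n`. The signs of `unifExp` make this raise the degree by `n` at either closed
  -- point.
  have hF : IsFrame L (Function.update (fun y => (g y).1) x e)
      (Function.update c x (c x - unifExp x * n)) := by
    refine ⟨fun y m => ?_, fun y a b hab => ?_, fun y => ?_⟩
    · by_cases hy : y = x
      · subst hy
        simpa using generates_of_smul_eq he (hgen y) h m
      · simpa [hy] using hgen y m (mem_of_ne φ hy m)
    · by_cases hy : y = x
      · subst hy
        rw [Function.update_self] at hab
        refine hfree y a b ?_
        rw [← h, ← mul_smul, ← mul_smul, mul_comm a, mul_comm b, mul_smul, mul_smul, hab]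
      · rw [Function.update_of_ne hy] at hab
        exact hfree y a b hab
    · rw [Function.update_of_ne hx.symm]
      by_cases hy : y = x
      · subst hy
        rw [Function.update_self, Function.update_self]
        refine LMod.mono_smul_cancel (unifExp y * n) ?_
        rw [← LMod.toGen_coord_pow_smul, h, hglue, ← mul_smul, ← mono_add]
        congr 2
        ring
      · rw [Function.update_of_ne hy, Function.update_of_ne hy, hglue]
  refine hF.iso_of_eq ?_
  cases x
  · simp [unifExp]
    linarith
  · simp [unifExp]
    linarith
  · exact absurd rfl hx

open Classical in
/-- The subsheaf generated by a power of the local coordinate in a line bundle. -/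
theorem exists_powSub_iso_line {L : LMod} {x : P1} {n : ℕ} {m : ℤ} (hx : x ≠ P1.gen)
    {e : ∀ y, L.M y} {c : P1 → ℤ} (he : IsFrame L e c) (hc : c P1.infty - c P1.zero = n + m) :
    Nonempty (LIso (powSub hx n e).toLMod (lineData m)) := by
  -- The inverse change of frame: multiplying the generator at `x` by `u ^ n` lowers the degree by
  -- `n`.
  have hF : IsFrame (powSub hx n e).toLMod
      (fun y => ⟨Function.update e x (coord x ^ n • e x) y, by
        rintro rfl
        exact ⟨1, by rw [one_smul, Function.update_self]⟩⟩)
      (Function.update c x (c x + unifExp x * n)) := by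
    refine ⟨fun y m => ?_, fun y a b hab => ?_, fun y => Subtype.ext ?_⟩
    · by_cases hy : y = x
      · subst hy
        obtain ⟨a, ha⟩ := m.2 rfl
        refine ⟨a, Subtype.ext ?_⟩
        change a • Function.update e y _ y = m.1
        rw [Function.update_self, ha]
      · obtain ⟨a, ha⟩ := he.generates y m.1
        refine ⟨a, Subtype.ext ?_⟩
        change a • Function.update e x _ y = m.1
        rw [Function.update_of_ne hy, ha]
    · have hab : a • Function.update e x (coord x ^ n • e x) y =
        b • Function.update e x (coord x ^ n • e x) y := congrArg Subtype.val hab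
      by_cases hy : y = x
      · subst hy
        rw [Function.update_self, ← mul_smul, ← mul_smul, mul_comm a, mul_comm b] at hab
        exact Osec_mul_left_cancel (coord_pow_ne_zero y n) (he.free y _ _ hab)
      · rw [Function.update_of_ne hy] at hab
        exact he.free y a b hab
    · change L.toGen y (Function.update e x (coord x ^ n • e x) y) =
        mono _ • Function.update e x (coord x ^ n • e x) P1.gen
      rw [Function.update_of_ne hx.symm]
      by_cases hy : y = x
      · subst hy
        rw [Function.update_self, Function.update_self, LMod.toGen_coord_pow_smul, he.glue,
          ← mul_smul, ← mono_add, add_comm]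
      · rw [Function.update_of_ne hy, Function.update_of_ne hy, he.glue]
  refine hF.iso_of_eq ?_
  cases x
  · simp [unifExp]
    linarith
  · simp [unifExp]
    linarith
  · exact absurd rfl hx

theorem tor_mul_line {x : P1} (n : ℕ+) (m : ℤ) (hx : x ≠ P1.gen) :
    IsHallProduct (delta (tor x n)) (delta (line m))
      (delta (line (n + m)) + delta ((tor x n).sum (line m))) := by
  refine isHallProduct_pair (A' := torData x n) (B' := lineData m) (C' := lineData (n + m))
    (D' := (torData x n).sum (lineData m)) (.germsGlue _) (.germsGlue _) (.germsGlue _)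
    (.germsSum (.germsGlue _) (.germsGlue _)) (fun e => ?_) (fun L hL P hP => ?_) (fun L φ => ?_)
    fun L φ => ?_
  -- A line bundle is cyclic at `x`, while the direct sum needs two generators there.
  · exact LSub.not_cyclicAt_sum (torData_not_zeroAt hx n) (lineData_not_zeroAt m x) e
      (lineData_cyclicAt _ x)
  · obtain ⟨⟨φ⟩, ⟨ψ⟩⟩ := id hP
    have hF := (isFrame_lineData m).map ψ.symm
    obtain ⟨e, he⟩ := exists_lift_generator P φ
    rcases coord_pow_smul_eq hx hL n.pos φ he (ψ.symm.equiv x (1 : Osec (nhd x))).2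
      (fun m hm => by
        obtain ⟨a, ha⟩ := hF.generates x ⟨m, hm⟩
        exact ⟨a, congrArg Subtype.val ha⟩) with h | h
    · exact Or.inr (iso_sum_of_smul_eq_zero hx hP he h)
    · exact Or.inl (exists_iso_line_of_smul_eq hx φ hF (by simp) he h)
  · have hF := (isFrame_lineData (n + m)).map φ.symm
    refine existsUnique_isExt_of_powSub hx (hF.generates x) (fun k hk => ?_)
      (exists_powSub_iso_line hx hF (by simp))
    -- By freeness, `u ^ k e = a u ^ n e` gives the divisibility of `u ^ k` by `u ^ n`.
    obtain ⟨a, ha⟩ := mem_powSub.1 hk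
    rw [← mul_smul] at ha
    rw [← coord_pow_dvd_iff hx, ← hF.free x _ _ ha]
    exact dvd_mul_left _ _
  · refine LSub.existsUnique_isExt φ ?_
    rintro P Q R hP hc ⟨eQ⟩ ⟨eR⟩
    refine LSub.ext fun y => (hc.eq_or_eq eQ eR hP (torData_cyclicAt x n y)
      (lineData_cyclicAt m y)).resolve_left fun h => ?_
    obtain ⟨eB⟩ := hP.2
    exact lineData_not_zeroAt m y (eB.zeroAt (LSub.zeroAt_of_torsionAt h.symm
      (eQ.symm.torsionAt (torData_toGen hx)) (eB.symm.torsionFree (lineData_torsionFree m))))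

/-! ## Products of torsion sheaves -/

/-- The condition `m ≠ n` enters only in the uniqueness for the direct sum: the annihilating powers
of `u` tell the two summands apart. -/
theorem tor_mul_tor {x : P1} (n m : ℕ+) (hx : x ≠ P1.gen) (hnm : m ≠ n) :
    IsHallProduct (delta (tor x n)) (delta (tor x m))
      (delta (tor x (n + m)) + delta ((tor x n).sum (tor x m))) := by
  refine isHallProduct_pair (A' := torData x n) (B' := torData x m) (C' := torData x (n + m))
    (D' := (torData x n).sum (torData x m)) (.germsGlue _) (.germsGlue _) (.germsGlue _)
    (.germsSum (.germsGlue _) (.germsGlue _)) (fun e => ?_) (fun L hL P hP => ?_) (fun L φ => ?_)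
    fun L φ => ?_
  · exact LSub.not_cyclicAt_sum (torData_not_zeroAt hx n) (torData_not_zeroAt hx m) e
      (torData_cyclicAt x _ x)
  · obtain ⟨⟨φ⟩, ⟨ψ⟩⟩ := id hP
    obtain ⟨e, he⟩ := exists_lift_generator P φ
    have hgen : ∀ m' ∈ P.carrier x, ∃ a : Osec (nhd x),
        a • (ψ.symm.equiv x (torGen x m x)).1 = m' := by
      intro m' hm
      obtain ⟨a, ha⟩ := torGen_generates x m x (ψ.equiv x ⟨m', hm⟩)
      have h : a • ψ.symm.equiv x (torGen x m x) = ⟨m', hm⟩ := by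
        rw [← ψ.symm.map_smul, ha]
        exact (ψ.equiv x).symm_apply_apply _
      exact ⟨a, congrArg Subtype.val h⟩
    rcases coord_pow_smul_eq hx hL n.pos φ he (ψ.symm.equiv x (torGen x m x)).2 hgen with h | h
    · exact Or.inr (iso_sum_of_smul_eq_zero hx hP he h)
    -- Since `u ^ n e` is the generator of `P`, whose order is `m`, the order of `e` is `n + m`.
    · have hiff : ∀ k, coord x ^ (k + n : ℕ) • e = 0 ↔ (m : ℕ) ≤ k := by
        intro k
        rw [← LMod.coord_pow_smul_smul, h, ← coord_pow_dvd_iff hx, ← torGen_smul_eq_zero_iff,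
          ← ψ.symm.map_eq_zero, ψ.symm.map_smul]
        exact ⟨fun h => Subtype.ext h, fun h => congrArg Subtype.val h⟩
      refine Or.inl (exists_torData_iso hx (fun y hy m' => ?_) (generates_of_smul_eq he hgen h) ?_
        fun k hk h0 => ?_)
      · have h0 := ψ.symm.zeroAt (torData_zeroAt (n := m) hy) ⟨m', mem_of_ne φ hy m'⟩
        exact congrArg Subtype.val h0
      · rw [add_comm, hiff]
      -- With truncated subtraction the exponent is the maximum of `k` and `n`, which has the form
      -- needed for `hiff`; if `k < n`, the result `m ≤ 0` contradicts positivity.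
      · have h1 : coord x ^ (k - n + n : ℕ) • e = 0 := by
          by_cases hkn : (n : ℕ) ≤ k
          · rwa [Nat.sub_add_cancel hkn]
          · obtain ⟨l, hl⟩ := Nat.exists_eq_add_of_le (not_le.1 hkn).le
            rw [Nat.sub_eq_zero_of_le (not_le.1 hkn).le, zero_add, hl, add_comm,
              ← LMod.coord_pow_smul_smul, h0, smul_zero]
        have h2 := (hiff _).1 h1
        have := m.pos
        omega
  · let e : ∀ y, L.M y := fun y => φ.symm.equiv y (torGen x (n + m) y)
    have he : ∀ y m, ∃ a : Osec (nhd y), a • e y = m := by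
      intro y m'
      obtain ⟨a, ha⟩ := torGen_generates x (n + m) y (φ.equiv y m')
      refine ⟨a, ?_⟩
      change a • φ.symm.equiv y _ = m'
      rw [← φ.symm.map_smul, ha]
      exact (φ.equiv y).symm_apply_apply _
    have hrel : ∀ a b : Osec (nhd x), a • e x = b • e x →
        a = b ∨ coord x ^ (n + m : ℕ) ∣ a ∧ coord x ^ (n + m : ℕ) ∣ b := by
      intro a b h
      change a • φ.symm.equiv x _ = b • φ.symm.equiv x _ at h
      rw [← φ.symm.map_smul, ← φ.symm.map_smul] at h
      simpa using (torGen_smul_eq_iff _ _ _ _ _).1 ((φ.symm.equiv x).injective h)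
    have hzero : ∀ a : Osec (nhd x), a • e x = 0 ↔ coord x ^ (n + m : ℕ) ∣ a := by
      intro a
      change a • φ.symm.equiv x _ = 0 ↔ _
      rw [← φ.symm.map_smul, φ.symm.map_eq_zero, torGen_smul_eq_zero_iff]
    refine existsUnique_isExt_of_powSub (e := e) hx (he x) (fun k hk => ?_) ?_
    · obtain ⟨a, ha⟩ := mem_powSub.1 hk
      rw [← mul_smul] at ha
      rw [← coord_pow_dvd_iff hx]
      -- Two multiples of `e` agree only if the coefficients agree or both lie in the annihilator
      -- `(u ^ (n + m))`; in either case `u ^ n` divides `u ^ k`.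
      rcases hrel _ _ ha with h | ⟨-, h⟩
      · rw [← h]
        exact dvd_mul_left _ _
      · exact (pow_dvd_pow _ (Nat.le_add_right _ _)).trans h
    · have hmem : coord x ^ (n : ℕ) • e x ∈ (powSub hx n e).carrier x :=
        mem_powSub.2 ⟨1, one_smul _ _⟩
      refine exists_torData_iso hx (fun y hy => ?_) (e := ⟨_, hmem⟩) (fun m' => ?_)
        (Subtype.ext ?_) fun k hk h => ?_
      · exact (LSub.zeroAt_iff _ y).2 (Set.eq_singleton_iff_unique_mem.2
          ⟨LSub.zero_mem _ y, fun m' _ => φ.symm.zeroAt (torData_zeroAt hy) m'⟩)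
      · obtain ⟨a, ha⟩ := mem_powSub.1 m'.2
        exact ⟨a, Subtype.ext ha⟩
      · change coord x ^ (m : ℕ) • coord x ^ (n : ℕ) • e x = 0
        rw [LMod.coord_pow_smul_smul, hzero, add_comm]
      · have h : coord x ^ k • coord x ^ (n : ℕ) • e x = 0 := congrArg Subtype.val h
        rw [LMod.coord_pow_smul_smul, hzero, coord_pow_dvd_iff hx] at h
        omega
  · refine LSub.existsUnique_isExt φ ?_
    rintro P Q R hP hc ⟨eQ⟩ ⟨eR⟩
    refine LSub.ext fun y => ?_
    by_cases hy : y = x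
    · subst hy
      refine (hc.eq_or_eq eQ eR hP (torData_cyclicAt y n y)
        (torData_cyclicAt y m y)).resolve_left fun h => hnm (PNat.eq ?_)
      obtain ⟨eB⟩ := hP.2
      -- If `P` were `Q` at the support, the same powers of `u` would annihilate modules of lengths
      -- `m` and `n`.
      have hk : ∀ k : ℕ, (m : ℕ) ≤ k ↔ (n : ℕ) ≤ k := by
        intro k
        rw [← torData_killedAt_iff hx, ← torData_killedAt_iff hx]
        have : P.toLMod.KilledAt y k ↔ Q.toLMod.KilledAt y k := by
          rw [LSub.killedAt_iff, LSub.killedAt_iff, h]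
        exact ⟨fun h => eQ.killedAt (this.1 (eB.symm.killedAt h)),
          fun h => eB.killedAt (this.2 (eQ.symm.killedAt h))⟩
      exact ((hk n).2 le_rfl).antisymm ((hk m).1 le_rfl)
    · exact hc.eq_of_zeroAt eQ eR hP (Or.inl (torData_zeroAt hy))

/-- At every point at least one of the two sheaves vanishes, so `P` is zero or everything there;
this gives both the splitting and the uniqueness. -/
theorem tor_mul_tor_of_ne {x x' : P1} (n m : ℕ+) (hx' : x' ≠ P1.gen)
    (hxx' : x ≠ x') :
    IsHallProduct (delta (tor x n)) (delta (tor x' m)) (delta ((tor x n).sum (tor x' m))) := by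
  refine isHallProduct_single (A' := torData x n) (B' := torData x' m)
    (.germsGlue _) (.germsGlue _) (.germsSum (.germsGlue _) (.germsGlue _)) (fun L _ P hP => ?_)
    fun L φ => LSub.existsUnique_isExt φ ?_
  · obtain ⟨⟨φ⟩, ⟨ψ⟩⟩ := id hP
    have hP0 : ∀ y, y ≠ x' → ∀ m ∈ P.carrier y, m = 0 := by
      intro y hy m' hm
      rw [(P.zeroAt_iff y).1 (ψ.symm.zeroAt (torData_zeroAt hy))] at hm
      exact hm
    refine LSub.iso_sum_of_complement hP (fun y a m' hm h => ?_)
      fun y m' _ h => hP0 P1.gen hx'.symm _ h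
    by_cases hy : y = x
    · exact hP0 y (hy ▸ hxx') _ h
    · exact absurd (mem_of_ne φ hy m') hm
  · rintro P Q R hP hc ⟨eQ⟩ ⟨eR⟩
    refine LSub.ext fun y => hc.eq_of_zeroAt eQ eR hP ?_
    by_cases hy : y = x
    · exact Or.inr (torData_zeroAt (hy ▸ hxx'))
    · exact Or.inl (torData_zeroAt hy)

/-! ## Products with cyclic sheaves -/

theorem cycHom_t_zpow (n : ℕ+) (k : ℤ) :
    cycHom n (t ^ k) = ((Multiplicative.ofAdd (k : ZMod n) : Multiplicative (ZMod n)) :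
      WithZero (Multiplicative (ZMod n))) := by
  rw [t, ← WithZero.coe_zpow, ← ofAdd_zsmul, smul_eq_mul, mul_one]
  rfl

theorem cycHom_ne_zero (n : ℕ+) {a : K} (ha : a ≠ 0) : cycHom n a ≠ 0 := by
  obtain ⟨k, rfl⟩ := exists_eq_t_zpow ha
  rw [cycHom_t_zpow]
  exact WithZero.coe_ne_zero

theorem cycData_torsionFree (n : ℕ+) : (cycData n).TorsionFree where
  smul x a m h := by
    change WithZero (Multiplicative (ZMod n)) at m
    have h : cycHom n (Oval x a) * m = 0 := h
    refine (mul_eq_zero.1 h).imp_left fun h => Oval_injective x ?_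
    rw [map_zero]
    exact not_not.1 fun h0 => cycHom_ne_zero n h0 h
  toGen _ _ h := h

/-- Every class modulo `n` has a non-negative and a non-positive representative, so the powers of
`t`, or of `t⁻¹`, alone reach every class. -/
theorem exists_mem_stalk_cycHom_eq (n : ℕ+) (x : P1) (i : ZMod n) :
    ∃ a ∈ stalk x, cycHom n a = ((Multiplicative.ofAdd i : Multiplicative (ZMod n)) :
      WithZero (Multiplicative (ZMod n))) := by
  cases x
  · refine ⟨t ^ (i.val : ℤ), Or.inr ⟨i.val, zpow_natCast _ _⟩, ?_⟩
    rw [cycHom_t_zpow]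
    simp
  -- The negated standard representative of `-i` is a non-positive representative of `i`.
  · refine ⟨t ^ (-((-i).val : ℤ)), Or.inr ⟨(-i).val, by
      rw [zpow_neg, zpow_natCast, inv_pow]⟩, ?_⟩
    rw [cycHom_t_zpow]
    simp
  · refine ⟨t ^ (i.val : ℤ), trivial, ?_⟩
    rw [cycHom_t_zpow]
    simp

/-- The functions act transitively on the non-zero elements of a cyclic sheaf. -/
theorem cycData_transitive (n : ℕ+) (x : P1) {z : (cycData n).M x} (hz : z ≠ 0)
    (z' : (cycData n).M x) : ∃ a : Osec (nhd x), a • z = z' := by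
  by_cases hz' : z' = 0
  · exact ⟨0, by rw [hz', zero_smul]⟩
  obtain ⟨i, rfl⟩ := WithZero.ne_zero_iff_exists.1 hz
  obtain ⟨j, rfl⟩ := WithZero.ne_zero_iff_exists.1 hz'
  obtain ⟨a, ha, h⟩ := exists_mem_stalk_cycHom_eq n x
    (Multiplicative.toAdd j - Multiplicative.toAdd i)
  refine ⟨Oconst x a ha, ?_⟩
  change cycHom n a * _ = _
  rw [h, ← WithZero.coe_mul]
  congr 1
  exact sub_add_cancel (Multiplicative.toAdd j) (Multiplicative.toAdd i)

theorem cycData_not_zeroAt (n : ℕ+) (x : P1) : ¬ (cycData n).ZeroAt x := fun h =>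
  one_ne_zero (α := WithZero (Multiplicative (ZMod n))) (h _)

theorem cycData_cyclicAt (n : ℕ+) (x : P1) : (cycData n).CyclicAt x :=
  ⟨_, fun m => cycData_transitive n x (z := (1 : WithZero (Multiplicative (ZMod n))))
    (one_ne_zero (α := WithZero (Multiplicative (ZMod n)))) m⟩

/-! ### Direct summands of coherent gluing data -/

namespace LSub

variable {L : LMod} {Q R : LSub L}

theorem Compl.fg (h : Compl Q R) (hL : L.FG) : R.toLMod.FG := by
  intro x
  obtain ⟨S, hS, hg⟩ := hL x
  -- A generator from the other summand contributes only `0` to `R`; `0` is added because there may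
  -- be no generator in `R` to produce it.
  refine ⟨(Subtype.val ⁻¹' S) ∪ {(0 : R.carrier x)},
    (hS.preimage Subtype.val_injective.injOn).union (Set.finite_singleton _), fun m => ?_⟩
  obtain ⟨a, s, hs, has⟩ := hg m.1
  rcases h.mem_or_mem x s with hQ | hR
  · have h0 : m.1 = 0 := h.eq_zero x _ (by
      rw [← has]
      exact Q.smul_mem x a s hQ) m.2
    exact ⟨0, 0, Or.inr rfl, Subtype.ext ((zero_smul _ _).trans h0.symm)⟩
  · exact ⟨a, ⟨s, hR⟩, Or.inl hs, Subtype.ext has⟩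

theorem Compl.qcoh (h : Compl Q R) (hL : L.QCoh) : R.toLMod.QCoh := by
  intro x
  constructor
  · intro m'
    obtain ⟨k, m, hm⟩ := (hL x).1 m'.1
    rcases h.mem_or_mem x m with hQ | hR
    -- If the numerator lies in `Q`, the common value lies in both summands and is zero, so `0`
    -- serves as numerator.
    · have h0 : Ores (nhd_gen_le x) (coord x ^ k) • m'.1 = 0 := h.eq_zero _ _ (by
        rw [hm]
        exact Q.toGen_mem x m hQ) (R.smul_mem _ _ _ m'.2)
      exact ⟨k, 0, (Subtype.ext h0 : Ores (nhd_gen_le x) (coord x ^ k) • m' = 0).trans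
        (R.toLMod.toGen_zero x).symm⟩
    · exact ⟨k, ⟨m, hR⟩, Subtype.ext hm⟩
  · intro m m' hm
    obtain ⟨k, hk⟩ := (hL x).2 m.1 m'.1 (congrArg Subtype.val hm)
    exact ⟨k, Subtype.ext hk⟩

/-- The part of `R` that lies in `P`, inside `P`. -/
def restrict (P R : LSub L) : LSub P.toLMod where
  carrier x := {m | m.1 ∈ R.carrier x}
  zero_mem x := R.zero_mem x
  smul_mem x a m hm := R.smul_mem x a m.1 hm
  toGen_mem x m hm := R.toGen_mem x m.1 hm

theorem Compl.restrict (h : Compl Q R) (P : LSub L) : Compl (P.restrict Q) (P.restrict R) :=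
  ⟨fun x m => h.mem_or_mem x m.1, fun x m hQ hR => Subtype.ext (h.eq_zero x m.1 hQ hR)⟩

/-- A submodule that is contained in another one. -/
def isoRestrict {P Q : LSub L} (h : ∀ x, Q.carrier x ⊆ P.carrier x) :
    LIso Q.toLMod (P.restrict Q).toLMod where
  equiv x := ⟨fun m => ⟨⟨m.1, h x m.2⟩, m.2⟩, fun m => ⟨m.1.1, m.2⟩, fun _ => rfl, fun _ => rfl⟩
  map_smul _ _ _ := rfl
  map_toGen _ _ := rfl

end LSub

/-- Decomposability in terms of gluing data. -/
theorem NCoh.Indecomposable.zeroAt_or_zeroAt {F : NCoh} (hF : F.Indecomposable) {L : LMod}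
    (e : LIso F.mod.germs L) {Q R : LSub L} (h : LSub.Compl Q R) :
    (∀ x, Q.toLMod.ZeroAt x) ∨ ∀ x, R.toLMod.ZeroAt x := by
  have hfg := e.fg F.coherent.1
  have hqc := e.qcoh F.coherent.2
  have hn : L.Normal := by
    intro x a m m' hm hne
    refine (e.symm.equiv x).injective (F.normal x a _ _ ?_ fun h0 => hne ?_)
    · exact (e.symm.map_smul x a m).symm.trans
        ((congrArg _ hm).trans (e.symm.map_smul x a m'))
    · exact (e.symm.map_eq_zero x).1 ((e.symm.map_smul x a m).trans h0)
  -- Both summands inherit coherence and normality, so they are admissible in the definition of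
  -- indecomposability.
  let G : NCoh := ⟨Q.toLMod.glue, LMod.glue_coherent _ (h.symm.fg hfg) (h.symm.qcoh hqc),
    LMod.glue_normal _ (Q.toLMod_normal hn)⟩
  let H : NCoh := ⟨R.toLMod.glue, LMod.glue_coherent _ (h.fg hfg) (h.qcoh hqc),
    LMod.glue_normal _ (R.toLMod_normal hn)⟩
  have key : ∀ M : LMod, (∀ U (s : M.glue.Sec U), s = 0) → ∀ x, M.ZeroAt x := fun M h0 x =>
    (LIso.germsGlue M).zeroAt fun m => h0 (nhd x) m
  refine (hF G H ?_).imp (key _) (key _)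
  exact (NCoh.equiv_iff_of_iso (G := G.sum H) (.germsSum (.germsGlue _) (.germsGlue _))).2
    ⟨e.trans h.isoSum.symm⟩

/-- Splitting comes from torsion freeness of the cyclic sheaf. For uniqueness, transitivity leaves
only `Q ⊆ P` or `Q ∩ P = 0`, uniformly in the point. In the first case `Q` is a non-zero summand of
the indecomposable `P`, so `P = Q`, which contradicts `hne`. -/
theorem cyc_mul_indecomposable (n : ℕ+) {F : NCoh} (hF : F.Indecomposable)
    (hne : delta F ≠ delta (cyc n)) :
    IsHallProduct (delta (cyc n)) (delta F) (delta ((cyc n).sum F)) := by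
  refine isHallProduct_single (A' := cycData n) (B' := F.mod.germs) (.germsGlue _) (.refl _)
    (.germsSum (.germsGlue _) (.refl _))
    (fun L _ P hP => LSub.iso_sum_of_torsionFree hP (cycData_torsionFree n))
    fun L φ => LSub.existsUnique_isExt φ ?_
  rintro P Q R hP hc ⟨eQ⟩ ⟨eR⟩
  obtain ⟨⟨eA⟩, ⟨eB⟩⟩ := hP
  have htrans : ∀ x, ∀ q ∈ Q.carrier x, q ∈ P.carrier x → q ≠ 0 →
      Q.carrier x ⊆ P.carrier x := by
    intro x q hq hqP hq0 q' hq'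
    obtain ⟨a, ha⟩ := cycData_transitive n x (z := eQ.equiv x ⟨q, hq⟩)
      (fun h => hq0 (congrArg Subtype.val ((eQ.map_eq_zero x).1 h))) (eQ.equiv x ⟨q', hq'⟩)
    have h : a • q = q' := congrArg Subtype.val
      ((eQ.equiv x).injective ((eQ.map_smul x a ⟨q, hq⟩).trans ha))
    rw [← h]
    exact P.smul_mem x a q hqP
  -- Towards the generic point: a non-zero element of `Q` has non-zero image, and transitivity
  -- yields the rest. Back: the quotient by `P` is torsion free, so an element whose image is in `P`
  -- is in `P`.
  have hgen : ∀ x, Q.carrier x ⊆ P.carrier x ↔ Q.carrier P1.gen ⊆ P.carrier P1.gen := by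
    intro x
    have htP := eA.symm.torsionFree (cycData_torsionFree n)
    constructor
    · intro h
      obtain ⟨q, hq⟩ := not_forall.1 fun h : Q.toLMod.ZeroAt x =>
        cycData_not_zeroAt n x (eQ.zeroAt h)
      refine htrans P1.gen (L.toGen x q.1) (Q.toGen_mem x _ q.2) (P.toGen_mem x _ (h q.2)) ?_
      exact fun h0 => hq ((eQ.symm.torsionFree (cycData_torsionFree n)).toGen x q (Subtype.ext h0))
    · intro h q hq
      rw [← P.proj_eq_zero]
      refine htP.toGen x _ ?_
      rw [← P.proj_toGen, P.proj_eq_zero]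
      exact h (Q.toGen_mem x q hq)
  by_cases hQP : Q.carrier P1.gen ⊆ P.carrier P1.gen
  · have hle : ∀ x, Q.carrier x ⊆ P.carrier x := fun x => (hgen x).2 hQP
    exfalso
    have eQ' := (LSub.isoRestrict hle).symm.trans eQ
    rcases hF.zeroAt_or_zeroAt eB.symm (hc.restrict P) with h | h
    · exact cycData_not_zeroAt n P1.gen (eQ'.zeroAt (h P1.gen))
    · have hPQ : P = Q := by
        refine LSub.ext fun x => Set.Subset.antisymm (fun m hm => ?_) (hle x)
        refine (hc.mem_or_mem x m).elim id fun hR => ?_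
        have h0 : m = 0 :=
          congrArg (fun p : (P.restrict R).carrier x => p.1.1) (h x ⟨⟨m, hm⟩, hR⟩)
        rw [h0]
        exact Q.zero_mem x
      subst hPQ
      refine hne ?_
      have : F ≈ cyc n := (NCoh.equiv_iff_of_iso (G := cyc n) (.germsGlue _)).2
        ⟨eB.symm.trans eQ⟩
      rw [delta, delta, Quotient.sound this]
  -- Now `P` meets `Q` only in `0`, so `P ⊆ R`. Conversely the cyclic quotient forces `P` to contain
  -- a summand, which cannot be `Q`.
  · refine LSub.ext fun x => Set.Subset.antisymm (fun m hm => ?_) ?_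
    · refine (hc.mem_or_mem x m).elim (fun hQ => ?_) id
      by_cases hm0 : m = 0
      · rw [hm0]
        exact R.zero_mem x
      · exact absurd ((hgen x).1 (htrans x m hQ hm hm0)) hQP
    · exact (hc.le_or_le_of_quot P (eA.symm.cyclicAt (cycData_cyclicAt n x))).resolve_left
        fun h => hQP ((hgen x).1 h)

end FunP1

end

open FunP1 in
theorem mainTheorem5 :
    (∀ n m : ℤ, m ≠ n →
      IsHallProduct (delta (line n)) (delta (line m)) (delta ((line n).sum (line m)))) ∧
    (∀ (x : P1) (n : ℕ+) (m : ℤ), x ≠ P1.gen →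
      IsHallProduct (delta (tor x n)) (delta (line m))
        (delta (line (n + m)) + delta ((tor x n).sum (line m)))) ∧
    (∀ (x : P1) (n : ℕ+) (m : ℤ), x ≠ P1.gen →
      IsHallProduct (delta (line m)) (delta (tor x n)) (delta ((tor x n).sum (line m)))) ∧
    (∀ (x : P1) (n m : ℕ+), x ≠ P1.gen → m ≠ n →
      IsHallProduct (delta (tor x n)) (delta (tor x m))
        (delta (tor x (n + m)) + delta ((tor x n).sum (tor x m)))) ∧
    (∀ (x x' : P1) (n m : ℕ+), x ≠ P1.gen → x' ≠ P1.gen → x ≠ x' →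
      IsHallProduct (delta (tor x n)) (delta (tor x' m))
        (delta ((tor x n).sum (tor x' m)))) ∧
    (∀ (n : ℕ+) (F : NCoh), F.Indecomposable → delta F ≠ delta (cyc n) →
      IsHallProduct (delta (cyc n)) (delta F) (delta ((cyc n).sum F))) := by
  exact ⟨fun _ _ h => line_mul_line h, fun _ n m hx => tor_mul_line n m hx,
    fun _ n m hx => line_mul_tor n m hx, fun _ n m hx hnm => tor_mul_tor n m hx hnm,
    fun _ _ n m _ hx' hxx' => tor_mul_tor_of_ne n m hx' hxx',
    fun n _ hF hne => cyc_mul_indecomposable n hF hne⟩
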